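/- **Theorem (Subtraction).** Let $\Sigma$ be a finite alphabet and let regular expressions over $\Sigma$ be built from $\phi,\varepsilon$, letters $x$, $+$, $\cdot$ and ${}^*$. Let $d_x(r)$ denote the Brzozowski derivative. Call $r,s$ *similar* if they are related by the congruence generated by $r+r\sim r$, $r+s\sim s+r$, $r+(s+t)\sim(r+s)+t$, $\varepsilon\cdot r\sim r$, $\phi\cdot r\sim\phi$, $\phi+r\sim r$, $r+\phi\sim r$. Fix any map $\mathrm{cnf}$ that sends each regular expression to a similar one and takes equal values on similar expressions (a choice of canonical representatives). Let $D(r)$ be the set of all $\mathrm{cnf}(r')$, where $r'$ is obtained from $r$ by taking zero or more successive derivatives. *Equations.* For regular expressions $r,s$ let $\mathcal S_{r,s}$ consist of one equation for each variable $R_{r',s'}$, $(r',s')\in D(r)\times D(s)$: if $\mathcal L(r')=\emptyset$ it is $R_{r',s'}\approx\phi$, and otherwise $$R_{r',s'}\approx\sum_{x\in\Sigma}x\cdot R_{\mathrm{cnf}(d_x(r')),\,\mathrm{cnf}(d_x(s'))}+t,$$ where $t=\varepsilon$ if $\varepsilon\in\mathcal L(r')$ and $\varepsilon\notin\mathcal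 L(s')$, and $t=\phi$ otherwise (sums are associated to the right). *Solving.* On expressions over letters and variables let $\simeq$ be the equivalence relation generated by $\gamma_1(\gamma_2+\gamma_3)\simeq\gamma_1\gamma_2+\gamma_1\gamma_3$, $\gamma_1(\gamma_2\gamma_3)\simeq(\gamma_1\gamma_2)\gamma_3$, $\gamma_1+(\gamma_2+\gamma_3)\simeq(\gamma_1+\gamma_2)+\gamma_3$, $\gamma_2\gamma_1+\gamma_3\gamma_1\simeq(\gamma_2+\gamma_3)\gamma_1$, $\gamma_1+\gamma_2\simeq\gamma_2+\gamma_1$, applied to whole expressions or to summands. An equation $R\approx\alpha$ is in *normal form* if $R$ does not occur in $\alpha$, or $\alpha=s_1\cdot R_1+\dots+s_n\cdot R_n+t$ with $n\ge1$, $R_1=R$, pairwise distinct variables $R_i$ and variable-free $s_i,t$. To solve a set of equations, first replace each right-hand side by a $\simeq$-equivalent one so that all equations are in normal form. Then, starting with the empty substitution $\psi$, apply the following two steps in any order until no equation is left: - (Arden) replace an equation $R\approx s\cdot R+\alpha$, with $s$ variable-free and $R$ not occurring in $\alpha$, by $R\approx s^*\cdot\alpha$; - (Subst) remove an equation $R\approx\alpha$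 with $R$ not occurring in $\alpha$, replace every other right-hand side $\alpha'$ by some $\alpha''\simeq\alpha'[R\mapsto\alpha]$, apply $[R\mapsto\alpha]$ to all values of $\psi$, and add $R\mapsto\alpha$ to $\psi$. For a final substitution $\psi$ so obtained from $\mathcal S_{r,s}$, put $r-s:=\psi(R_{\mathrm{cnf}(r),\mathrm{cnf}(s)})$. *Ambiguity.* Parse trees record how an expression is matched: $\mathrm{Eps}$ is a tree for $\varepsilon$, $\mathrm{Sym}\,x$ for $x$, $\mathrm{Seq}\,v_1\,v_2$ for $r_1\cdot r_2$, $\mathrm{Inl}\,v_1$ and $\mathrm{Inr}\,v_2$ for $r_1+r_2$ (where $v_i$ is a tree for $r_i$), and a finite list of trees for $r$ is a tree for $r^*$. An expression is *unambiguous* if no two distinct parse trees for it have the same underlying word. *Claim.* For all regular expressions $r,s$, the solving process for $\mathcal S_{r,s}$ has at least one run that terminates with no equation left, so that a value $r-s$ exists. For every such run, the resulting value $r-s$ is a regular expression (it contains no variables), it is unambiguous, and $\mathcal L(r-s)=\mathcal L(r)\setminus\mathcal L(s)$. -/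

import Mathlib

/-! ### Canonical descendants -/

/-- Similarity of regular expressions: the smallest congruence containing idempotency,
commutativity and associativity of `+` and the four elimination rules. -/
inductive RESimilar {α : Type*} : RegularExpression α → RegularExpression α → Prop
  | idem (r) : RESimilar (r + r) r
  | comm (r s) : RESimilar (r + s) (s + r)
  | assoc (r s t) : RESimilar (r + (s + t)) ((r + s) + t)
  | elim1 (r) : RESimilar (1 * r) r
  | elim2 (r) : RESimilar (0 * r) 0
  | elim3 (r) : RESimilar (0 + r) r
  | elim4 (r) : RESimilar (r + 0) r
  | plus_congr {r r₁ s s₁} : RESimilar r r₁ → RESimilar s s₁ → RESimilar (r + s) (r₁ + s₁)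
  | comp_congr {r r₁ s s₁} : RESimilar r r₁ → RESimilar s s₁ → RESimilar (r * s) (r₁ * s₁)
  | star_congr {r r₁} : RESimilar r r₁ → RESimilar r.star r₁.star
  | refl (r) : RESimilar r r
  | symm {r s} : RESimilar r s → RESimilar s r
  | trans {r s t} : RESimilar r s → RESimilar s t → RESimilar r t

/-- `cnf` picks a canonical representative out of every similarity class. -/
structure IsCanonicalForm {α : Type*} (cnf : RegularExpression α → RegularExpression α) :
    Prop where
  similar : ∀ r, RESimilar (cnf r) r
  eq_of_similar : ∀ r s, RESimilar r s → cnf r = cnf s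

/-- Number of nodes of a regular expression. -/
def reSize {α : Type*} : RegularExpression α → ℕ
  | 0 => 1
  | 1 => 1
  | .char _ => 1
  | r + s => reSize r + reSize s + 1
  | r * s => reSize r + reSize s + 1
  | .star r => reSize r + 1

/-- The nodes of a regular expression in preorder, each one labelled by the size of the
subexpression below it and by its symbol. -/
def reCode {α : Type*} : RegularExpression α → List (ℕ ×ₗ (α ⊕ₗ Fin 5))
  | 0 => [toLex (1, toLex (.inr 0))]
  | 1 => [toLex (1, toLex (.inr 1))]
  | .char x => [toLex (1, toLex (.inl x))]
  | .star r => toLex (reSize r + 1, toLex (.inr 2)) :: reCode r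
  | r * s => toLex (reSize r + reSize s + 1, toLex (.inr 3)) :: (reCode r ++ reCode s)
  | r + s => toLex (reSize r + reSize s + 1, toLex (.inr 4)) :: (reCode r ++ reCode s)

theorem reCode_wellFounded {α : Type*} [Finite α] [LinearOrder α] :
    WellFounded (InvImage (List.Shortlex (· < ·)) (reCode (α := α))) :=
  InvImage.wf _ (List.Shortlex.wf
    (WellFounded.prod_lex wellFounded_lt (Sum.lex_wf wellFounded_lt wellFounded_lt)))

/-- The concrete canonical form relative to a total order of the alphabet: the least similar
expression when expressions are compared by size first and then, recursively from left to right,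
by head symbol and subexpressions. In it sums are associated to the right, their summands are
sorted by size and symbols, and idempotency and the elimination rules are used exhaustively. -/
noncomputable def sizeCnf {α : Type*} [Finite α] [LinearOrder α] (r : RegularExpression α) :
    RegularExpression α :=
  reCode_wellFounded.min {s | RESimilar s r} ⟨r, RESimilar.refl r⟩

/-- Canonical forms exist. -/
theorem isCanonicalForm_sizeCnf {α : Type*} [Finite α] [LinearOrder α] :
    IsCanonicalForm (sizeCnf (α := α)) where
  similar r := reCode_wellFounded.min_mem {s | RESimilar s r} ⟨r, RESimilar.refl r⟩
  eq_of_similar r s h := by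
    have : {t | RESimilar t r} = {t | RESimilar t s} :=
      Set.ext fun t => ⟨fun ht => ht.trans h, fun ht => ht.trans h.symm⟩
    simp only [sizeCnf, this]

/-- A descendant of `r` is `r` itself or the (Brzozowski) derivative of a descendant. -/
inductive IsDescendant {α : Type*} [DecidableEq α] (r : RegularExpression α) :
    RegularExpression α → Prop
  | self : IsDescendant r r
  | deriv {d} (x : α) : IsDescendant r d → IsDescendant r (d.deriv x)

/-- The canonical representatives of the descendants of `r`. -/
def canonicalDescendants {α : Type*} [DecidableEq α]
    (cnf : RegularExpression α → RegularExpression α) (r : RegularExpression α) :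
    Set (RegularExpression α) :=
  {c | ∃ d, IsDescendant r d ∧ cnf d = c}

/-! ### Regular equations -/

/-- Expressions over letters from `α` and variables (regular language symbols) from `V`. -/
abbrev MixedExpr (α V : Type*) := RegularExpression (α ⊕ V)

/-- A variable as an expression. -/
def mvar {α V : Type*} (R : V) : MixedExpr α V := .char (.inr R)

/-- A regular expression as an expression without variables. -/
def embed {α V : Type*} (r : RegularExpression α) : MixedExpr α V := r.map Sum.inl

/-- The variable `R` occurs in the expression. -/
def Occurs {α V : Type*} (R : V) : MixedExpr α V → Prop
  | 0 => False
  | 1 => False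
  | .char (.inl _) => False
  | .char (.inr S) => S = R
  | γ + δ => Occurs R γ ∨ Occurs R δ
  | γ * δ => Occurs R γ ∨ Occurs R δ
  | .star γ => Occurs R γ

open Classical in
/-- Apply the substitution `R ↦ β` to an expression. -/
noncomputable def substVar {α V : Type*} (R : V) (β : MixedExpr α V) :
    MixedExpr α V → MixedExpr α V
  | 0 => 0
  | 1 => 1
  | .char (.inl x) => .char (.inl x)
  | .char (.inr S) => if S = R then β else .char (.inr S)
  | γ + δ => substVar R β γ + substVar R β δ
  | γ * δ => substVar R β γ * substVar R β δ
  | .star γ => .star (substVar R β γ)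

/-- A finite or infinite set of equations `R ≈ β` with distinct left-hand sides; likewise a
substitution `R ↦ β`. The value at `R` is the right-hand side for `R`, or `none` if there is
none. -/
abbrev EqSystem (α V : Type*) := V → Option (MixedExpr α V)

/-- The empty set of equations, or the empty substitution. -/
def emptySystem {α V : Type*} : EqSystem α V := fun _ => none

/-- The sum `s₁ · R₁ + (s₂ · R₂ + (⋯ + t))`. -/
def linearSum {α V : Type*} (l : List (RegularExpression α × V)) (t : RegularExpression α) :
    MixedExpr α V :=
  l.foldr (fun p γ => embed p.1 * mvar p.2 + γ) (embed t)

/-- The equation `R ≈ β` is in normal form. -/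
def IsNormalForm {α V : Type*} (R : V) (β : MixedExpr α V) : Prop :=
  ¬ Occurs R β ∨
    ∃ (s : RegularExpression α) (l : List (RegularExpression α × V)) (t : RegularExpression α),
      β = linearSum ((s, R) :: l) t ∧ (((s, R) :: l).map Prod.snd).Nodup

/-- The equivalence of expressions generated by distributivity, associativity and commutativity,
applied to summands. -/
inductive ExprEquiv {α V : Type*} : MixedExpr α V → MixedExpr α V → Prop
  | e1 (γ₁ γ₂ γ₃) : ExprEquiv (γ₁ * (γ₂ + γ₃)) (γ₁ * γ₂ + γ₁ * γ₃)
  | e2 (γ₁ γ₂ γ₃) : ExprEquiv (γ₁ * (γ₂ * γ₃)) ((γ₁ * γ₂) * γ₃)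
  | e3 (γ₁ γ₂ γ₃) : ExprEquiv (γ₁ + (γ₂ + γ₃)) ((γ₁ + γ₂) + γ₃)
  | e4 (γ₁ γ₂ γ₃) : ExprEquiv (γ₂ * γ₁ + γ₃ * γ₁) ((γ₂ + γ₃) * γ₁)
  | e5 (γ₁ γ₂) : ExprEquiv (γ₁ + γ₂) (γ₂ + γ₁)
  | e6_left {γ₁ γ₂} (β) : ExprEquiv γ₁ γ₂ → ExprEquiv (γ₁ + β) (γ₂ + β)
  | e6_right {γ₁ γ₂} (β) : ExprEquiv γ₁ γ₂ → ExprEquiv (β + γ₁) (β + γ₂)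
  | e7 {γ₁ γ₂ γ₃} : ExprEquiv γ₁ γ₂ → ExprEquiv γ₂ γ₃ → ExprEquiv γ₁ γ₃
  | refl (γ) : ExprEquiv γ γ
  | symm {γ₁ γ₂} : ExprEquiv γ₁ γ₂ → ExprEquiv γ₂ γ₁

open Classical in
/-- One solving step between configurations (solution so far, remaining equations). -/
inductive SolveStep {α V : Type*} :
    EqSystem α V × EqSystem α V → EqSystem α V × EqSystem α V → Prop
  | arden (ψ E : EqSystem α V) (R : V) (s : RegularExpression α) (β : MixedExpr α V) :
      E R = some (embed s * mvar R + β) → ¬ Occurs R β →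
      SolveStep (ψ, E) (ψ, Function.update E R (some (embed s.star * β)))
  | subst (ψ E E₁ : EqSystem α V) (R : V) (β : MixedExpr α V) :
      E R = some β → ¬ Occurs R β → E₁ R = none →
      (∀ S, S ≠ R → Option.Rel (fun γ δ => ExprEquiv (substVar R β γ) δ) (E S) (E₁ S)) →
      SolveStep (ψ, E)
        (Function.update (fun S => (ψ S).map (substVar R β)) R (some β), E₁)

/-- `ψ` is obtained from the equations `E` by bringing them into normal form and then solving
until no equation is left. The order of the solving steps is not fixed. -/
def Solves {α V : Type*} (E ψ : EqSystem α V) : Prop :=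
  ∃ E₁ : EqSystem α V,
    (∀ R, Option.Rel ExprEquiv (E R) (E₁ R)) ∧
    (∀ R β, E₁ R = some β → IsNormalForm R β) ∧
    Relation.ReflTransGen SolveStep (emptySystem, E₁) (ψ, emptySystem)

/-! ### Parse trees and ambiguity -/

/-- Parse trees; `nil` and `cons` build the lists that match a star. -/
inductive ParseTree (α : Type*)
  | eps : ParseTree α
  | sym : α → ParseTree α
  | seq : ParseTree α → ParseTree α → ParseTree α
  | inl : ParseTree α → ParseTree α
  | inr : ParseTree α → ParseTree α
  | nil : ParseTree α
  | cons : ParseTree α → ParseTree α → ParseTree α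
  | fold : ParseTree α → ParseTree α

/-- The word underlying a parse tree. -/
def ParseTree.flatten {α : Type*} : ParseTree α → List α
  | .eps => []
  | .sym x => [x]
  | .seq v w => v.flatten ++ w.flatten
  | .inl v => v.flatten
  | .inr v => v.flatten
  | .nil => []
  | .cons v vs => v.flatten ++ vs.flatten
  | .fold v => v.flatten

/-- `IsParse E v γ`: with respect to the equations `E`, `v` is a parse tree for `γ`. -/
inductive IsParse {α V : Type*} (E : EqSystem α V) : ParseTree α → MixedExpr α V → Prop
  | eps : IsParse E .eps 1
  | sym (x : α) : IsParse E (.sym x) (.char (.inl x))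
  | seq {v₁ v₂ γ₁ γ₂} : IsParse E v₁ γ₁ → IsParse E v₂ γ₂ → IsParse E (.seq v₁ v₂) (γ₁ * γ₂)
  | inl {v γ₁ γ₂} : IsParse E v γ₁ → IsParse E (.inl v) (γ₁ + γ₂)
  | inr {v γ₁ γ₂} : IsParse E v γ₂ → IsParse E (.inr v) (γ₁ + γ₂)
  | nil {γ} : IsParse E .nil (.star γ)
  | cons {v vs γ} : IsParse E v γ → IsParse E vs (.star γ) → IsParse E (.cons v vs) (.star γ)
  | fold {v R β} : E R = some β → IsParse E v β → IsParse E (.fold v) (mvar R)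

/-- `γ` is ambiguous with respect to `E`: two distinct parse trees have the same word. -/
def IsAmbiguous {α V : Type*} (E : EqSystem α V) (γ : MixedExpr α V) : Prop :=
  ∃ v₁ v₂ : ParseTree α,
    v₁ ≠ v₂ ∧ IsParse E v₁ γ ∧ IsParse E v₂ γ ∧ v₁.flatten = v₂.flatten

/-! ### Subtraction -/

open Classical in
/-- The right-hand side of the equation for the variable indexed by the pair `(r, s)`. -/
noncomputable def subtractionRhs {α : Type*} [Fintype α] [DecidableEq α]
    (cnf : RegularExpression α → RegularExpression α) (r s : RegularExpression α) :
    MixedExpr α (RegularExpression α × RegularExpression α) :=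
  if r.matches' = 0 then 0
  else
    (Finset.univ : Finset α).toList.foldr
      (fun x γ => .char (.inl x) * mvar (cnf (r.deriv x), cnf (s.deriv x)) + γ)
      (if [] ∈ r.matches' ∧ [] ∉ s.matches' then 1 else 0)

open Classical in
/-- The equations for the subtraction of `s` from `r`: one for every pair of canonical
descendants. -/
noncomputable def subtractionEquations {α : Type*} [Fintype α] [DecidableEq α]
    (cnf : RegularExpression α → RegularExpression α) (r s : RegularExpression α) :
    EqSystem α (RegularExpression α × RegularExpression α) :=
  fun p =>
    if p.1 ∈ canonicalDescendants cnf r ∧ p.2 ∈ canonicalDescendants cnf s then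
      some (subtractionRhs cnf p.1 p.2)
    else none

/-- `γ` is a value of `r - s`: it is what solving the subtraction equations yields for the
variable that belongs to `r` and `s`. -/
def IsSubtraction {α : Type*} [Fintype α] [DecidableEq α]
    (cnf : RegularExpression α → RegularExpression α) (r s : RegularExpression α)
    (γ : MixedExpr α (RegularExpression α × RegularExpression α)) : Prop :=
  ∃ ψ, Solves (subtractionEquations cnf r s) ψ ∧ ψ (cnf r, cnf s) = some γ

/-! Interpret the variable indexed by (r', s') as L(r') \ L(s'). A word x·w lies in this difference
exactly when w lies in the difference of the two x-derivatives, so this interpretation solves all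
equations, and the summands of a right-hand side are disjoint because they begin with different
letters. The fixed interpretation is carried through the process (`SolveStep.invariant`): every
right-hand side, pending or solved, keeps denoting the language of its variable, stays unambiguous,
and mentions only variables that still have an equation. When no equation is left, the values are
therefore variable-free.

Unambiguity in the presence of variables is semantic (`Unamb`): disjoint sums and unique
factorization in products and stars. A factor of a product is constrained only when the other factor
has a nonempty language. Without this proviso distributivity would break it: if γ₁ is empty, γ₁γ₂ +
γ₁γ₃ says nothing about disjointness of γ₂ and γ₃. Parse trees do not notice, since an empty product
has none (`Unamb.parse_unique`).

For Arden's rule, let M = LM + N with LM uniquely factorized and disjoint from N. Two factorizations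
of a word in L*N agree by peeling off first factors (`flatten_append_injective`), so s*·α is
unambiguous. That it denotes M needs ε ∉ L; this comes from a further invariant, `Guarded`:
variables stand at the right end of products, behind a factor without ε. Initially that factor is a
letter.

A run exists because there are finitely many derivatives up to similarity
(`exists_finite_derivClosed`), linear sums can be brought to normal form, and each elimination
removes one variable. -/

/-! ### Languages and unambiguity relative to an interpretation of the variables -/

section Semantics

open scoped Computability Classical

variable {α V : Type*}

/-- The language of an expression when the variables are interpreted by `ρ`. -/
def mixedLang (ρ : V → Language α) : MixedExpr α V → Language α
  | 0 => 0
  | 1 => 1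
  | .char (.inl x) => {[x]}
  | .char (.inr R) => ρ R
  | γ + δ => mixedLang ρ γ + mixedLang ρ δ
  | γ * δ => mixedLang ρ γ * mixedLang ρ δ
  | .star γ => (mixedLang ρ γ)∗

/-- Every word has at most one factorization into a word of `L` and a word of `M`. -/
def UniqueConcat (L M : Language α) : Prop :=
  ∀ a ∈ L, ∀ a' ∈ L, ∀ b ∈ M, ∀ b' ∈ M, a ++ b = a' ++ b' → a = a' ∧ b = b'

/-- Every word has at most one factorization into words of `L`. -/
def UniqueStar (L : Language α) : Prop :=
  ∀ l l' : List (List α), (∀ y ∈ l, y ∈ L) → (∀ y ∈ l', y ∈ L) → l.flatten = l'.flatten → l = l'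

/-- Unambiguity of an expression, described by properties of the languages of its
subexpressions. Factors of an empty product are not restricted. -/
def Unamb (ρ : V → Language α) : MixedExpr α V → Prop
  | 0 => True
  | 1 => True
  | .char _ => True
  | γ + δ => Unamb ρ γ ∧ Unamb ρ δ ∧ ∀ w ∈ mixedLang ρ γ, w ∉ mixedLang ρ δ
  | γ * δ => ((∃ w, w ∈ mixedLang ρ δ) → Unamb ρ γ) ∧ ((∃ w, w ∈ mixedLang ρ γ) → Unamb ρ δ) ∧
      UniqueConcat (mixedLang ρ γ) (mixedLang ρ δ)
  | .star γ => Unamb ρ γ ∧ UniqueStar (mixedLang ρ γ)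

variable (ρ : V → Language α)

@[simp] theorem mixedLang_add (γ δ : MixedExpr α V) :
    mixedLang ρ (γ + δ) = mixedLang ρ γ + mixedLang ρ δ := rfl

@[simp] theorem mixedLang_mul (γ δ : MixedExpr α V) :
    mixedLang ρ (γ * δ) = mixedLang ρ γ * mixedLang ρ δ := rfl

@[simp] theorem mixedLang_mvar (R : V) : mixedLang ρ (mvar R : MixedExpr α V) = ρ R := rfl

theorem unamb_add (γ δ : MixedExpr α V) : Unamb ρ (γ + δ) ↔
    Unamb ρ γ ∧ Unamb ρ δ ∧ ∀ w ∈ mixedLang ρ γ, w ∉ mixedLang ρ δ := Iff.rfl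

theorem unamb_mul (γ δ : MixedExpr α V) : Unamb ρ (γ * δ) ↔
    ((∃ w, w ∈ mixedLang ρ δ) → Unamb ρ γ) ∧ ((∃ w, w ∈ mixedLang ρ γ) → Unamb ρ δ) ∧
      UniqueConcat (mixedLang ρ γ) (mixedLang ρ δ) := Iff.rfl

theorem unamb_star (γ : MixedExpr α V) : Unamb ρ (RegularExpression.star γ) ↔
    Unamb ρ γ ∧ UniqueStar (mixedLang ρ γ) := Iff.rfl

theorem mixedLang_embed (r : RegularExpression α) :
    mixedLang ρ (embed r : MixedExpr α V) = r.matches' := by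
  induction r with
  | zero => rfl
  | epsilon => rfl
  | char x => rfl
  | plus r s ihr ihs => exact congrArg₂ (· + ·) ihr ihs
  | comp r s ihr ihs => exact congrArg₂ (· * ·) ihr ihs
  | star r ih => exact congrArg (·∗) ih

/-! ### Invariance under `ExprEquiv` -/

theorem mixedLang_eq_of_exprEquiv {γ δ : MixedExpr α V} (h : ExprEquiv γ δ) :
    mixedLang ρ γ = mixedLang ρ δ := by
  induction h with
  | e1 => exact mul_add _ _ _
  | e2 => exact (mul_assoc _ _ _).symm
  | e3 => exact (add_assoc _ _ _).symm
  | e4 => exact (add_mul _ _ _).symm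
  | e5 => exact add_comm _ _
  | e6_left β _ ih => exact congrArg (· + mixedLang ρ β) ih
  | e6_right β _ ih => exact congrArg (mixedLang ρ β + ·) ih
  | e7 _ _ ih₁ ih₂ => exact ih₁.trans ih₂
  | refl => rfl
  | symm _ ih => exact ih.symm

/-- A common word of M and N yields a common word of LM and LN only after prefixing a word of L;
hence disjointness on the right is conditional on L being inhabited. -/
theorem uniqueConcat_add_right {L M N : Language α} :
    (UniqueConcat L M ∧ UniqueConcat L N ∧ ∀ w ∈ L * M, w ∉ L * N) ↔
      UniqueConcat L (M + N) ∧ ((∃ w, w ∈ L) → ∀ w ∈ M, w ∉ N) := by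
  constructor
  · rintro ⟨h₁, h₂, h₃⟩
    refine ⟨?_, fun ⟨w, hw⟩ v hv hv' =>
      h₃ _ (Language.append_mem_mul hw hv) (Language.append_mem_mul hw hv')⟩
    rintro a ha a' ha' b (hb | hb) b' (hb' | hb') e
    · exact h₁ a ha a' ha' b hb b' hb' e
    · exact (h₃ _ (Language.append_mem_mul ha hb) (e ▸ Language.append_mem_mul ha' hb')).elim
    · exact (h₃ _ (Language.append_mem_mul ha' hb') (e ▸ Language.append_mem_mul ha hb)).elim
    · exact h₂ a ha a' ha' b hb b' hb' e
  · rintro ⟨h, hd⟩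
    refine ⟨fun a ha a' ha' b hb b' hb' => h a ha a' ha' b (.inl hb) b' (.inl hb'),
      fun a ha a' ha' b hb b' hb' => h a ha a' ha' b (.inr hb) b' (.inr hb'), ?_⟩
    rintro _ ⟨a, ha, b, hb, rfl⟩ ⟨a', ha', b', hb', e⟩
    obtain ⟨rfl, rfl⟩ := h a' ha' a ha b' (.inr hb') b (.inl hb) e
    exact hd ⟨_, ha⟩ _ hb hb'

theorem uniqueConcat_add_left {L M N : Language α} :
    (UniqueConcat M L ∧ UniqueConcat N L ∧ ∀ w ∈ M * L, w ∉ N * L) ↔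
      UniqueConcat (M + N) L ∧ ((∃ w, w ∈ L) → ∀ w ∈ M, w ∉ N) := by
  constructor
  · rintro ⟨h₁, h₂, h₃⟩
    refine ⟨?_, fun ⟨w, hw⟩ v hv hv' =>
      h₃ _ (Language.append_mem_mul hv hw) (Language.append_mem_mul hv' hw)⟩
    rintro a (ha | ha) a' (ha' | ha') b hb b' hb' e
    · exact h₁ a ha a' ha' b hb b' hb' e
    · exact (h₃ _ (Language.append_mem_mul ha hb) (e ▸ Language.append_mem_mul ha' hb')).elim
    · exact (h₃ _ (Language.append_mem_mul ha' hb') (e ▸ Language.append_mem_mul ha hb)).elim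
    · exact h₂ a ha a' ha' b hb b' hb' e
  · rintro ⟨h, hd⟩
    refine ⟨fun a ha a' ha' => h a (.inl ha) a' (.inl ha'),
      fun a ha a' ha' => h a (.inr ha) a' (.inr ha'), ?_⟩
    rintro _ ⟨a, ha, b, hb, rfl⟩ ⟨a', ha', b', hb', e⟩
    obtain ⟨rfl, rfl⟩ := h a' (.inr ha') a (.inl ha) b' hb' b hb e
    exact hd ⟨_, hb⟩ _ ha ha'

/-- Both sides express unique factorization of triple products. The condition on an inner pair comes
from padding with a fixed word of the third language, which is why it presupposes such a word. -/
theorem uniqueConcat_assoc {L M N : Language α} :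
    (UniqueConcat L (M * N) ∧ ((∃ w, w ∈ L) → UniqueConcat M N)) ↔
      (UniqueConcat (L * M) N ∧ ((∃ w, w ∈ N) → UniqueConcat L M)) := by
  constructor
  · rintro ⟨h₁, h₂⟩
    constructor
    · rintro _ ⟨a, ha, b, hb, rfl⟩ _ ⟨a', ha', b', hb', rfl⟩ c hc c' hc' e
      have := h₁ a ha a' ha' _ (Language.append_mem_mul hb hc) _
        (Language.append_mem_mul hb' hc') (by simpa using e)
      have h' := h₂ ⟨a, ha⟩ b hb b' hb' c hc c' hc' this.2
      simp [this.1, h'.1, h'.2]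
    · rintro ⟨c, hc⟩ a ha a' ha' b hb b' hb' e
      have h := h₁ a ha a' ha' _ (Language.append_mem_mul hb hc) _
        (Language.append_mem_mul hb' hc) (by simp only [← List.append_assoc, e])
      exact ⟨h.1, List.append_cancel_right h.2⟩
  · rintro ⟨h₁, h₂⟩
    constructor
    · rintro a ha a' ha' _ ⟨b, hb, c, hc, rfl⟩ _ ⟨b', hb', c', hc', rfl⟩ e
      have := h₁ _ (Language.append_mem_mul ha hb) _ (Language.append_mem_mul ha' hb')
        c hc c' hc' (by simpa using e)
      have h' := h₂ ⟨c, hc⟩ a ha a' ha' b hb b' hb' this.1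
      simp [this.2, h'.1, h'.2]
    · rintro ⟨a, ha⟩ b hb b' hb' c hc c' hc' e
      have h := h₁ _ (Language.append_mem_mul ha hb) _ (Language.append_mem_mul ha hb')
        c hc c' hc' (by simp only [List.append_assoc, e])
      exact ⟨List.append_cancel_left h.1, h.2⟩

theorem exists_mem_add {L M : Language α} :
    (∃ w, w ∈ L + M) ↔ (∃ w, w ∈ L) ∨ ∃ w, w ∈ M := exists_or

theorem exists_mem_mul {L M : Language α} :
    (∃ w, w ∈ L * M) ↔ (∃ w, w ∈ L) ∧ ∃ w, w ∈ M := by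
  constructor
  · rintro ⟨_, a, ha, b, hb, rfl⟩
    exact ⟨⟨a, ha⟩, ⟨b, hb⟩⟩
  · rintro ⟨⟨a, ha⟩, ⟨b, hb⟩⟩
    exact ⟨_, Language.append_mem_mul ha hb⟩

theorem unamb_mul_add (γ₁ γ₂ γ₃ : MixedExpr α V) :
    Unamb ρ (γ₁ * (γ₂ + γ₃)) ↔ Unamb ρ (γ₁ * γ₂ + γ₁ * γ₃) := by
  have h := uniqueConcat_add_right (L := mixedLang ρ γ₁) (M := mixedLang ρ γ₂)
    (N := mixedLang ρ γ₃)
  simp only [unamb_mul, unamb_add, mixedLang_add, mixedLang_mul, exists_mem_add]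
  generalize Unamb ρ γ₁ = U₁, Unamb ρ γ₂ = U₂, Unamb ρ γ₃ = U₃ at *
  generalize (∃ w, w ∈ mixedLang ρ γ₁) = N₁, (∃ w, w ∈ mixedLang ρ γ₂) = N₂,
    (∃ w, w ∈ mixedLang ρ γ₃) = N₃ at *
  grind

theorem unamb_add_mul (γ₁ γ₂ γ₃ : MixedExpr α V) :
    Unamb ρ (γ₂ * γ₁ + γ₃ * γ₁) ↔ Unamb ρ ((γ₂ + γ₃) * γ₁) := by
  have h := uniqueConcat_add_left (L := mixedLang ρ γ₁) (M := mixedLang ρ γ₂)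
    (N := mixedLang ρ γ₃)
  simp only [unamb_mul, unamb_add, mixedLang_add, mixedLang_mul, exists_mem_add]
  generalize Unamb ρ γ₁ = U₁, Unamb ρ γ₂ = U₂, Unamb ρ γ₃ = U₃ at *
  generalize (∃ w, w ∈ mixedLang ρ γ₁) = N₁, (∃ w, w ∈ mixedLang ρ γ₂) = N₂,
    (∃ w, w ∈ mixedLang ρ γ₃) = N₃ at *
  grind

theorem unamb_mul_assoc (γ₁ γ₂ γ₃ : MixedExpr α V) :
    Unamb ρ (γ₁ * (γ₂ * γ₃)) ↔ Unamb ρ ((γ₁ * γ₂) * γ₃) := by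
  have h := uniqueConcat_assoc (L := mixedLang ρ γ₁) (M := mixedLang ρ γ₂)
    (N := mixedLang ρ γ₃)
  simp only [unamb_mul, mixedLang_mul, exists_mem_mul]
  generalize Unamb ρ γ₁ = U₁, Unamb ρ γ₂ = U₂, Unamb ρ γ₃ = U₃ at *
  generalize (∃ w, w ∈ mixedLang ρ γ₁) = N₁, (∃ w, w ∈ mixedLang ρ γ₂) = N₂,
    (∃ w, w ∈ mixedLang ρ γ₃) = N₃ at *
  grind

theorem unamb_iff_of_exprEquiv {γ δ : MixedExpr α V} (h : ExprEquiv γ δ) :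
    Unamb ρ γ ↔ Unamb ρ δ := by
  induction h with
  | e1 => exact unamb_mul_add ρ _ _ _
  | e2 => exact unamb_mul_assoc ρ _ _ _
  | e3 =>
    simp only [unamb_add, mixedLang_add, Language.mem_add]
    grind
  | e4 => exact unamb_add_mul ρ _ _ _
  | e5 =>
    simp only [unamb_add]
    grind
  | e6_left β h ih => simp only [unamb_add, ih, mixedLang_eq_of_exprEquiv ρ h]
  | e6_right β h ih => simp only [unamb_add, ih, mixedLang_eq_of_exprEquiv ρ h]
  | e7 _ _ ih₁ ih₂ => exact ih₁.trans ih₂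
  | refl => rfl
  | symm _ ih => exact ih.symm

/-! ### Invariance under substitution -/

theorem mixedLang_substVar {R : V} {β : MixedExpr α V} (hβ : mixedLang ρ β = ρ R)
    (γ : MixedExpr α V) : mixedLang ρ (substVar R β γ) = mixedLang ρ γ := by
  induction γ with
  | zero => rfl
  | epsilon => rfl
  | char x =>
    rcases x with x | S
    · rfl
    · change mixedLang ρ (if S = R then β else .char (.inr S)) = ρ S
      split_ifs with h
      · rw [hβ, h]
      · rfl
  | plus γ δ ihγ ihδ => exact congrArg₂ (· + ·) ihγ ihδ
  | comp γ δ ihγ ihδ => exact congrArg₂ (· * ·) ihγ ihδ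
  | star γ ih => exact congrArg (·∗) ih

/-- Disjointness and unique factorization depend only on languages, and these do not change when R
is replaced by an expression for the language of R. -/
theorem unamb_substVar {R : V} {β : MixedExpr α V} (hβ : mixedLang ρ β = ρ R)
    (hu : Unamb ρ β) {γ : MixedExpr α V} (hγ : Unamb ρ γ) : Unamb ρ (substVar R β γ) := by
  induction γ with
  | zero => trivial
  | epsilon => trivial
  | char x =>
    rcases x with x | S
    · trivial
    · change Unamb ρ (if S = R then β else .char (.inr S))
      split_ifs
      · exact hu
      · trivial
  | plus γ δ ihγ ihδ =>
    change Unamb ρ (substVar R β γ + substVar R β δ)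
    rw [unamb_add, mixedLang_substVar ρ hβ, mixedLang_substVar ρ hβ]
    exact ⟨ihγ hγ.1, ihδ hγ.2.1, hγ.2.2⟩
  | comp γ δ ihγ ihδ =>
    change Unamb ρ (substVar R β γ * substVar R β δ)
    rw [unamb_mul, mixedLang_substVar ρ hβ, mixedLang_substVar ρ hβ]
    exact ⟨fun h => ihγ (hγ.1 h), fun h => ihδ (hγ.2.1 h), hγ.2.2⟩
  | star γ ih =>
    change Unamb ρ (RegularExpression.star (substVar R β γ))
    rw [unamb_star, mixedLang_substVar ρ hβ]
    exact ⟨ih hγ.1, hγ.2⟩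

/-! ### Arden's rule -/

/-- Unfolding M shows that a product of words of L followed by a word of N lies in M. So unique
factorization of LM identifies the first factors, and if one list ended before the other, a word of
N would lie in LM. -/
theorem flatten_append_injective {L M N : Language α} (hM : M = L * M + N)
    (hu : UniqueConcat L M) (hd : ∀ w ∈ L * M, w ∉ N) {l l' : List (List α)}
    (hl : ∀ y ∈ l, y ∈ L) (hl' : ∀ y ∈ l', y ∈ L) {b b' : List α} (hb : b ∈ N) (hb' : b' ∈ N)
    (e : l.flatten ++ b = l'.flatten ++ b') : l = l' ∧ b = b' := by
  have hstar : ∀ (l : List (List α)), (∀ y ∈ l, y ∈ L) → ∀ b ∈ N, l.flatten ++ b ∈ M := by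
    intro l
    induction l with
    | nil => intro _ b hb; rw [hM]; exact Or.inr hb
    | cons y l ih =>
      intro hl b hb
      rw [hM, List.flatten_cons, List.append_assoc]
      exact Or.inl (Language.append_mem_mul (hl y (by simp))
        (ih (fun z hz => hl z (by simp [hz])) b hb))
  induction l generalizing l' with
  | nil =>
    cases l' with
    | nil => exact ⟨rfl, by simpa using e⟩
    | cons y l' =>
      rw [List.flatten_cons, List.append_assoc, List.flatten_nil, List.nil_append] at e
      refine (hd b ?_ hb).elim
      rw [e]
      exact Language.append_mem_mul (hl' y (by simp))
        (hstar l' (fun z hz => hl' z (by simp [hz])) b' hb')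
  | cons x l ih =>
    have hx := hl x (by simp)
    have hl₁ : ∀ y ∈ l, y ∈ L := fun z hz => hl z (by simp [hz])
    cases l' with
    | nil =>
      rw [List.flatten_cons, List.append_assoc, List.flatten_nil, List.nil_append] at e
      refine (hd b' ?_ hb').elim
      rw [← e]
      exact Language.append_mem_mul hx (hstar l hl₁ b hb)
    | cons y l' =>
      have hl₁' : ∀ z ∈ l', z ∈ L := fun z hz => hl' z (by simp [hz])
      rw [List.flatten_cons, List.append_assoc, List.flatten_cons, List.append_assoc] at e
      obtain ⟨rfl, h⟩ := hu x hx y (hl' y (by simp)) _ (hstar l hl₁ b hb) _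
        (hstar l' hl₁' b' hb') e
      obtain ⟨rfl, rfl⟩ := ih hl₁ hl₁' h
      exact ⟨rfl, rfl⟩

theorem unamb_arden {s : RegularExpression α} {R : V} {β : MixedExpr α V}
    (hR : mixedLang ρ (embed s * mvar R + β) = ρ R) (hu : Unamb ρ (embed s * mvar R + β)) :
    Unamb ρ (embed s.star * β) := by
  obtain ⟨⟨hs, -, hc⟩, hβ, hd⟩ := hu
  rw [mixedLang_embed, mixedLang_mvar] at hc
  rw [mixedLang_mul, mixedLang_embed, mixedLang_mvar] at hd
  rw [mixedLang_add, mixedLang_mul, mixedLang_embed, mixedLang_mvar] at hR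
  refine ⟨?_, fun _ => hβ, ?_⟩
  · rintro ⟨b, hb⟩
    -- Since β has a word, the language of R is inhabited, so the condition on s is not vacuous.
    refine ⟨hs ⟨b, ?_⟩, ?_⟩
    · rw [mixedLang_mvar, ← hR]
      exact Or.inr hb
    · intro l l' hl hl' e
      change ∀ y ∈ l, y ∈ mixedLang ρ (embed s) at hl
      change ∀ y ∈ l', y ∈ mixedLang ρ (embed s) at hl'
      rw [mixedLang_embed] at hl hl'
      -- Appending the same b to both products reduces star factorizations to those of L*N.
      exact (flatten_append_injective hR.symm hc hd hl hl' hb hb (by rw [e])).1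
  · rw [mixedLang_embed]
    rintro _ ⟨l, rfl, hl⟩ _ ⟨l', rfl, hl'⟩ b hb b' hb' e
    obtain ⟨rfl, rfl⟩ := flatten_append_injective hR.symm hc hd hl hl' hb hb' e
    exact ⟨rfl, rfl⟩

theorem mixedLang_arden {s : RegularExpression α} {R : V} {β : MixedExpr α V}
    (hs : [] ∉ s.matches') (hR : mixedLang ρ (embed s * mvar R + β) = ρ R) :
    mixedLang ρ (embed s.star * β) = ρ R := by
  rw [mixedLang_add, mixedLang_mul, mixedLang_embed, mixedLang_mvar] at hR
  rw [mixedLang_mul, mixedLang_embed]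
  exact ((Language.self_eq_mul_add_iff hs).1 hR.symm).symm

/-! ### Parse trees of expressions without variables -/

theorem IsParse.flatten_mem {v : ParseTree α} {γ : MixedExpr α V}
    (h : IsParse emptySystem v γ) : v.flatten ∈ mixedLang ρ γ := by
  induction h with
  | eps => rfl
  | sym x => rfl
  | seq _ _ ih₁ ih₂ => exact Language.append_mem_mul ih₁ ih₂
  | inl _ ih => exact Or.inl ih
  | inr _ ih => exact Or.inr ih
  | nil => exact Language.nil_mem_kstar _
  | @cons v vs γ _ _ ih₁ ih₂ =>
    obtain ⟨l, hl, hm⟩ := ih₂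
    exact ⟨v.flatten :: l, by simp [ParseTree.flatten, hl], by simpa using ⟨ih₁, hm⟩⟩
  | fold h => simp [emptySystem] at h

/-- The trees in the list represented by a parse tree for a star. -/
def ParseTree.items : ParseTree α → List (ParseTree α)
  | .cons v vs => v :: vs.items
  | _ => []

/-- The star is hidden behind δ so that induction on the parse derivation applies. -/
theorem IsParse.star_items {v : ParseTree α} {γ δ : MixedExpr α V} (hδ : δ = .star γ)
    (h : IsParse emptySystem v δ) :
    v.flatten = (v.items.map ParseTree.flatten).flatten ∧
      (∀ u ∈ v.items, IsParse emptySystem u γ) := by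
  induction h with
  | nil => simp [ParseTree.flatten, ParseTree.items]
  | cons h₁ h₂ ih₁ ih₂ =>
    obtain ⟨e, hi⟩ := ih₂ hδ
    cases hδ
    simp only [ParseTree.flatten, ParseTree.items, List.map_cons, List.flatten_cons, ← e,
      List.mem_cons, forall_eq_or_imp]
    exact ⟨trivial, h₁, hi⟩
  | _ => cases hδ

theorem IsParse.star_ext {v v' : ParseTree α} {γ : MixedExpr α V}
    (h : IsParse emptySystem v (.star γ)) (h' : IsParse emptySystem v' (.star γ))
    (e : v.items = v'.items) : v = v' := by
  induction v generalizing v' with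
  | cons u vs _ ih =>
    cases h with
    | cons _ h₂ =>
      cases h' with
      | nil => simp [ParseTree.items] at e
      | cons _ h₂' =>
        simp only [ParseTree.items, List.cons.injEq] at e
        rw [e.1, ih h₂ h₂' e.2]
  | nil =>
    cases h' with
    | nil => rfl
    | cons _ _ => simp [ParseTree.items] at e
  | _ => cases h

theorem Unamb.parse_unique {γ : MixedExpr α V} (hu : Unamb ρ γ) {v v' : ParseTree α}
    (h : IsParse emptySystem v γ) (h' : IsParse emptySystem v' γ)
    (e : v.flatten = v'.flatten) : v = v' := by
  induction γ generalizing v v' with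
  | zero => cases h
  | epsilon =>
    cases h
    cases h'
    rfl
  | char x =>
    cases h with
    | sym x =>
      cases h'
      rfl
    | fold h _ => simp [emptySystem] at h
  | plus γ δ ihγ ihδ =>
    have hd := hu.2.2
    cases h with
    | inl h =>
      cases h' with
      | inl h' => rw [ihγ hu.1 h h' e]
      | inr h' => exact (hd _ (h.flatten_mem ρ) (e ▸ h'.flatten_mem ρ)).elim
    | inr h =>
      cases h' with
      | inl h' => exact (hd _ (h'.flatten_mem ρ) (e ▸ h.flatten_mem ρ)).elim
      | inr h' => rw [ihδ hu.2.1 h h' e]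
  | comp γ δ ihγ ihδ =>
    cases h with
    | seq h₁ h₂ =>
      cases h' with
      | seq h₁' h₂' =>
        have hw := hu.2.2 _ (h₁.flatten_mem ρ) _ (h₁'.flatten_mem ρ) _ (h₂.flatten_mem ρ) _
          (h₂'.flatten_mem ρ) e
        rw [ihγ (hu.1 ⟨_, h₂.flatten_mem ρ⟩) h₁ h₁' hw.1,
          ihδ (hu.2.1 ⟨_, h₁.flatten_mem ρ⟩) h₂ h₂' hw.2]
  | star γ ih =>
    obtain ⟨e₁, hi⟩ := IsParse.star_items rfl h
    obtain ⟨e₁', hi'⟩ := IsParse.star_items rfl h'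
    refine h.star_ext h' ?_
    -- Unique star factorization identifies the lists of words; the induction hypothesis then
    -- identifies the trees item by item.
    have hmap : v.items.map ParseTree.flatten = v'.items.map ParseTree.flatten := by
      refine hu.2 _ _ ?_ ?_ (by rw [← e₁, ← e₁', e])
      · simp only [List.mem_map]
        rintro _ ⟨u, hu, rfl⟩
        exact (hi u hu).flatten_mem ρ
      · simp only [List.mem_map]
        rintro _ ⟨u, hu, rfl⟩
        exact (hi' u hu).flatten_mem ρ
    have hlist : ∀ l l' : List (ParseTree α), (∀ u ∈ l, IsParse emptySystem u γ) →
        (∀ u ∈ l', IsParse emptySystem u γ) →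
        l.map ParseTree.flatten = l'.map ParseTree.flatten → l = l' := by
      intro l
      induction l with
      | nil => intro l' _ _ e; simpa using e.symm
      | cons u l ihl =>
        intro l' hl hl' e
        cases l' with
        | nil => simp at e
        | cons u' l' =>
          simp only [List.map_cons, List.cons.injEq] at e
          rw [ih hu.1 (hl u (by simp)) (hl' u' (by simp)) e.1,
            ihl l' (fun z hz => hl z (by simp [hz])) (fun z hz => hl' z (by simp [hz])) e.2]
    exact hlist _ _ hi hi' hmap

end Semantics

/-! ### Similarity classes and finiteness of the set of canonical descendants -/

section Descendants

variable {α : Type*}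

open scoped Computability

theorem RESimilar.matches'_eq {r s : RegularExpression α} (h : RESimilar r s) :
    r.matches' = s.matches' := by
  induction h with
  | idem r => exact Language.add_self _
  | comm r s => exact add_comm _ _
  | assoc r s t => exact (add_assoc _ _ _).symm
  | elim1 r => exact one_mul _
  | elim2 r => exact zero_mul _
  | elim3 r => exact zero_add _
  | elim4 r => exact add_zero _
  | plus_congr _ _ ih₁ ih₂ => exact congrArg₂ (· + ·) ih₁ ih₂
  | comp_congr _ _ ih₁ ih₂ => exact congrArg₂ (· * ·) ih₁ ih₂
  | star_congr _ ih => exact congrArg (·∗) ih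
  | refl r => rfl
  | symm _ ih => exact ih.symm
  | trans _ _ ih₁ ih₂ => exact ih₁.trans ih₂

theorem matchEpsilon_iff [DecidableEq α] (r : RegularExpression α) :
    r.matchEpsilon = true ↔ [] ∈ r.matches' :=
  r.rmatch_iff_matches' []

theorem cons_mem_matches'_iff [DecidableEq α] (r : RegularExpression α) (x : α) (w : List α) :
    x :: w ∈ r.matches' ↔ w ∈ (r.deriv x).matches' := by
  rw [← RegularExpression.rmatch_iff_matches', ← RegularExpression.rmatch_iff_matches']
  rfl

theorem RESimilar.matchEpsilon_eq [DecidableEq α] {r s : RegularExpression α}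
    (h : RESimilar r s) : r.matchEpsilon = s.matchEpsilon := by
  rw [Bool.eq_iff_iff, matchEpsilon_iff, matchEpsilon_iff, h.matches'_eq]

theorem deriv_mul_eq_ite [DecidableEq α] (r s : RegularExpression α) (x : α) :
    (r * s).deriv x = if r.matchEpsilon then r.deriv x * s + s.deriv x else r.deriv x * s := rfl

/-- The derivative of a product branches on nullability. Similar expressions have the same language,
so both sides take the same branch. -/
theorem RESimilar.deriv [DecidableEq α] {r s : RegularExpression α} (h : RESimilar r s) (x : α) :
    RESimilar (r.deriv x) (s.deriv x) := by
  induction h with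
  | idem r => exact .idem _
  | comm r s => exact .comm _ _
  | assoc r s t => exact .assoc _ _ _
  | elim1 r => exact ((RESimilar.elim2 r).plus_congr (.refl _)).trans (.elim3 _)
  | elim2 r => exact .elim2 _
  | elim3 r => exact .elim3 _
  | elim4 r => exact .elim4 _
  | plus_congr _ _ ih₁ ih₂ => exact .plus_congr ih₁ ih₂
  | comp_congr h₁ h₂ ih₁ ih₂ =>
    rw [deriv_mul_eq_ite, deriv_mul_eq_ite, h₁.matchEpsilon_eq]
    split_ifs
    · exact .plus_congr (.comp_congr ih₁ h₂) ih₂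
    · exact .comp_congr ih₁ h₂
  | star_congr h ih => exact .comp_congr ih (.star_congr h)
  | refl r => exact .refl _
  | symm _ ih => exact ih.symm
  | trans _ _ ih₁ ih₂ => exact ih₁.trans ih₂

/-- Similarity as a setoid. -/
def similarSetoid (α : Type*) : Setoid (RegularExpression α) where
  r := RESimilar
  iseqv := ⟨.refl, .symm, .trans⟩

/-- Regular expressions up to similarity. -/
def SimClass (α : Type*) : Type _ := Quotient (similarSetoid α)

/-- The similarity class of an expression. -/
def SimClass.mk (r : RegularExpression α) : SimClass α := Quotient.mk (similarSetoid α) r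

theorem SimClass.mk_eq_iff {r s : RegularExpression α} :
    SimClass.mk r = SimClass.mk s ↔ RESimilar r s :=
  Quotient.eq (r := similarSetoid α)

/-- The sum of similarity classes. -/
instance : Max (SimClass α) :=
  ⟨Quotient.map₂ (sa := similarSetoid α) (sb := similarSetoid α) (sc := similarSetoid α)
    (· + ·) fun _ _ h _ _ h' => RESimilar.plus_congr h h'⟩

/-- Sums make the similarity classes a semilattice. -/
instance : SemilatticeSup (SimClass α) :=
  SemilatticeSup.mk'
    (by
      rintro ⟨r⟩ ⟨s⟩
      exact SimClass.mk_eq_iff.2 (.comm r s))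
    (by
      rintro ⟨r⟩ ⟨s⟩ ⟨t⟩
      exact SimClass.mk_eq_iff.2 (RESimilar.assoc r s t).symm)
    (by
      rintro ⟨r⟩
      exact SimClass.mk_eq_iff.2 (.idem r))

/-- Multiplication by an expression from the right. -/
def SimClass.mulRight (s : RegularExpression α) : SimClass α → SimClass α :=
  Quotient.map (sa := similarSetoid α) (sb := similarSetoid α) (· * s)
    fun _ _ h => RESimilar.comp_congr h (.refl s)

/-- The derivative of a similarity class. -/
def SimClass.deriv [DecidableEq α] (x : α) : SimClass α → SimClass α :=
  Quotient.map (sa := similarSetoid α) (sb := similarSetoid α) (·.deriv x)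
    fun _ _ h => RESimilar.deriv h x

theorem SimClass.deriv_sup [DecidableEq α] (x : α) (a b : SimClass α) :
    (a ⊔ b).deriv x = a.deriv x ⊔ b.deriv x := by
  rcases a with ⟨r⟩
  rcases b with ⟨s⟩
  rfl

theorem SimClass.sup_zero (a : SimClass α) : a ⊔ .mk 0 = a := by
  rcases a with ⟨r⟩
  exact SimClass.mk_eq_iff.2 (.elim4 r)

theorem SimClass.deriv_mulRight [DecidableEq α] (x : α) (a : SimClass α)
    (s : RegularExpression α) :
    (a.mulRight s).deriv x = (a.deriv x).mulRight s ∨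
      (a.mulRight s).deriv x = (a.deriv x).mulRight s ⊔ (SimClass.mk s).deriv x := by
  rcases a with ⟨r⟩
  change SimClass.mk ((r * s).deriv x) = SimClass.mk (r.deriv x * s) ∨
    SimClass.mk ((r * s).deriv x) = SimClass.mk (r.deriv x * s + s.deriv x)
  rw [deriv_mul_eq_ite]
  split_ifs
  · exact .inr rfl
  · exact .inl rfl

/-- A set of similarity classes that contains all derivatives of its elements. -/
def DerivClosed [DecidableEq α] (T : Set (SimClass α)) : Prop :=
  ∀ a ∈ T, ∀ x, a.deriv x ∈ T

/-- Derivatives commute with sums, so it suffices to check the generators. -/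
theorem DerivClosed.supClosure [DecidableEq α] {T : Set (SimClass α)}
    (h : ∀ a ∈ T, ∀ x, a.deriv x ∈ supClosure T) : DerivClosed (supClosure T) := by
  intro a ha x
  refine supClosure_min (t := {a : SimClass α | a.deriv x ∈ _root_.supClosure T})
    (fun b hb => h b hb x) ?_ ha
  intro b hb c hc
  change (b ⊔ c).deriv x ∈ _root_.supClosure T
  rw [SimClass.deriv_sup]
  exact supClosed_supClosure hb hc

/-- Brzozowski's argument: an iterated derivative of r·s is a derivative of r times s plus a sum of
derivatives of s, and a proper one of r* is a sum of terms r'·r* with r' a derivative of r. In a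
semilattice, a finite set generates only finitely many sums. -/
theorem exists_finite_derivClosed [DecidableEq α] (r : RegularExpression α) :
    ∃ T : Set (SimClass α), T.Finite ∧ DerivClosed T ∧ SimClass.mk r ∈ T := by
  induction r with
  | zero =>
    refine ⟨{.mk 0}, Set.finite_singleton _, ?_, rfl⟩
    rintro _ rfl x
    rfl
  | epsilon =>
    refine ⟨{.mk 1, .mk 0}, Set.toFinite _, ?_, .inl rfl⟩
    rintro _ (rfl | rfl) x <;> exact .inr rfl
  | char y =>
    refine ⟨{.mk (.char y), .mk 1, .mk 0}, Set.toFinite _, ?_, .inl rfl⟩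
    rintro _ (rfl | rfl | rfl) x
    · change SimClass.mk (if y = x then 1 else 0) ∈ _
      split_ifs
      · exact .inr (.inl rfl)
      · exact .inr (.inr rfl)
    · exact .inr (.inr rfl)
    · exact .inr (.inr rfl)
  | plus r s ihr ihs =>
    obtain ⟨T, hT, hTd, hr⟩ := ihr
    obtain ⟨U, hU, hUd, hs⟩ := ihs
    refine ⟨Set.image2 (· ⊔ ·) T U, hT.image2 _ hU, ?_, ⟨_, hr, _, hs, rfl⟩⟩
    rintro _ ⟨a, ha, b, hb, rfl⟩ x
    exact ⟨_, hTd a ha x, _, hUd b hb x, (SimClass.deriv_sup x a b).symm⟩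
  | comp r s ihr ihs =>
    obtain ⟨T, hT, hTd, hr⟩ := ihr
    obtain ⟨U, hU, hUd, hs⟩ := ihs
    have hd : DerivClosed (supClosure (insert (SimClass.mk 0) U)) := by
      refine DerivClosed.supClosure ?_
      rintro a (rfl | ha) x
      · exact subset_supClosure (.inl rfl)
      · exact subset_supClosure (.inr (hUd a ha x))
    -- The class of 0 serves as the empty sum, so that r·s itself has the required shape.
    refine ⟨Set.image2 (fun a c => a.mulRight s ⊔ c) T (supClosure (insert (.mk 0) U)),
      hT.image2 _ (hU.insert _).supClosure, ?_,
      ⟨_, hr, .mk 0, subset_supClosure (.inl rfl), SimClass.sup_zero _⟩⟩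
    rintro _ ⟨a, ha, c, hc, rfl⟩ x
    refine ⟨a.deriv x, hTd a ha x, ?_⟩
    rw [SimClass.deriv_sup]
    rcases SimClass.deriv_mulRight x a s with h | h
    · exact ⟨c.deriv x, hd c hc x, by rw [h]⟩
    · exact ⟨(SimClass.mk s).deriv x ⊔ c.deriv x,
        supClosed_supClosure (subset_supClosure (.inr (hUd _ hs x))) (hd c hc x),
        by rw [h]; exact (sup_assoc _ _ _).symm⟩
  | star r ih =>
    obtain ⟨T, hT, hTd, hr⟩ := ih
    have hstar (x : α) : (SimClass.mk r.star).deriv x =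
        ((SimClass.mk r).deriv x).mulRight r.star := rfl
    have hd : DerivClosed (supClosure (SimClass.mulRight r.star '' T)) := by
      refine DerivClosed.supClosure ?_
      rintro _ ⟨a, ha, rfl⟩ x
      have h₁ := subset_supClosure (Set.mem_image_of_mem (SimClass.mulRight r.star) (hTd a ha x))
      rcases SimClass.deriv_mulRight x a r.star with h | h
      · rwa [h]
      · rw [h, hstar]
        exact supClosed_supClosure h₁
          (subset_supClosure (Set.mem_image_of_mem (SimClass.mulRight r.star) (hTd _ hr x)))
    refine ⟨insert (.mk r.star) (supClosure (SimClass.mulRight r.star '' T)),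
      (hT.image _).supClosure.insert _, ?_, .inl rfl⟩
    rintro a (rfl | ha) x
    · rw [hstar]
      exact .inr (subset_supClosure
        (Set.mem_image_of_mem (SimClass.mulRight r.star) (hTd _ hr x)))
    · exact .inr (hd a ha x)

variable [DecidableEq α] {cnf : RegularExpression α → RegularExpression α}

theorem finite_canonicalDescendants (hcnf : IsCanonicalForm cnf) (r : RegularExpression α) :
    (canonicalDescendants cnf r).Finite := by
  obtain ⟨T, hT, hTd, hr⟩ := exists_finite_derivClosed r
  have hdesc : ∀ d, IsDescendant r d → SimClass.mk d ∈ T := by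
    intro d hd
    induction hd with
    | self => exact hr
    | deriv x _ ih => exact hTd _ ih x
  refine Set.Finite.of_finite_image (f := SimClass.mk) (hT.subset ?_) ?_
  · rintro _ ⟨_, ⟨d, hd, rfl⟩, rfl⟩
    rw [SimClass.mk_eq_iff.2 (hcnf.similar d)]
    exact hdesc d hd
  · rintro _ ⟨d, -, rfl⟩ _ ⟨d', -, rfl⟩ h
    exact hcnf.eq_of_similar _ _ ((hcnf.similar d).symm.trans
      ((SimClass.mk_eq_iff.1 h).trans (hcnf.similar d')))

theorem cnf_deriv_mem_canonicalDescendants (hcnf : IsCanonicalForm cnf)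
    {r r' : RegularExpression α} (h : r' ∈ canonicalDescendants cnf r) (x : α) :
    cnf (r'.deriv x) ∈ canonicalDescendants cnf r := by
  obtain ⟨d, hd, rfl⟩ := h
  exact ⟨d.deriv x, hd.deriv x, hcnf.eq_of_similar _ _ ((hcnf.similar d).symm.deriv x)⟩

theorem cnf_mem_canonicalDescendants (r : RegularExpression α) :
    cnf r ∈ canonicalDescendants cnf r :=
  ⟨r, .self, rfl⟩

end Descendants

/-! ### Invariants of the solving process -/

section Invariants

open scoped Classical

variable {α V : Type*}

/-- No variable occurs in the expression. -/
def VarFree (γ : MixedExpr α V) : Prop := ∀ R, ¬ Occurs R γ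

/-- Variables occur only at the right end of products. -/
def RightLinear : MixedExpr α V → Prop
  | 0 => True
  | 1 => True
  | .char _ => True
  | γ + δ => RightLinear γ ∧ RightLinear δ
  | γ * δ => VarFree γ ∧ RightLinear δ
  | .star γ => VarFree γ

/-- Variables occur only at the right end of products, and every variable is preceded by a factor
whose language does not contain the empty word. -/
def Guarded (ρ : V → Language α) : MixedExpr α V → Prop
  | 0 => True
  | 1 => True
  | .char (.inl _) => True
  | .char (.inr _) => False
  | γ + δ => Guarded ρ γ ∧ Guarded ρ δ
  | γ * δ => VarFree γ ∧ RightLinear δ ∧ ([] ∉ mixedLang ρ γ ∨ Guarded ρ δ)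
  | .star γ => VarFree γ

theorem occurs_add (R : V) (γ δ : MixedExpr α V) :
    Occurs R (γ + δ) ↔ Occurs R γ ∨ Occurs R δ := Iff.rfl

theorem occurs_mul (R : V) (γ δ : MixedExpr α V) :
    Occurs R (γ * δ) ↔ Occurs R γ ∨ Occurs R δ := Iff.rfl

theorem occurs_mvar (R S : V) : Occurs R (mvar S : MixedExpr α V) ↔ S = R := Iff.rfl

theorem varFree_add (γ δ : MixedExpr α V) : VarFree (γ + δ) ↔ VarFree γ ∧ VarFree δ := by
  simp only [VarFree, occurs_add, not_or, forall_and]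

theorem varFree_mul (γ δ : MixedExpr α V) : VarFree (γ * δ) ↔ VarFree γ ∧ VarFree δ := by
  simp only [VarFree, occurs_mul, not_or, forall_and]

theorem rightLinear_add (γ δ : MixedExpr α V) :
    RightLinear (γ + δ) ↔ RightLinear γ ∧ RightLinear δ := Iff.rfl

theorem rightLinear_mul (γ δ : MixedExpr α V) :
    RightLinear (γ * δ) ↔ VarFree γ ∧ RightLinear δ := Iff.rfl

theorem guarded_add (ρ : V → Language α) (γ δ : MixedExpr α V) :
    Guarded ρ (γ + δ) ↔ Guarded ρ γ ∧ Guarded ρ δ := Iff.rfl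

theorem guarded_mul (ρ : V → Language α) (γ δ : MixedExpr α V) :
    Guarded ρ (γ * δ) ↔
      VarFree γ ∧ RightLinear δ ∧ ([] ∉ mixedLang ρ γ ∨ Guarded ρ δ) := Iff.rfl

theorem Guarded.rightLinear {ρ : V → Language α} {γ : MixedExpr α V} (h : Guarded ρ γ) :
    RightLinear γ := by
  induction γ with
  | zero => trivial
  | epsilon => trivial
  | char _ => trivial
  | plus γ δ ihγ ihδ => exact ⟨ihγ h.1, ihδ h.2⟩
  | comp γ δ ihγ ihδ => exact ⟨h.1, h.2.1⟩
  | star γ ih => exact h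

theorem not_occurs_embed (R : V) (s : RegularExpression α) :
    ¬ Occurs R (embed s : MixedExpr α V) := by
  induction s with
  | zero => exact id
  | epsilon => exact id
  | char _ => exact id
  | plus _ _ ih₁ ih₂ => exact fun h => h.elim ih₁ ih₂
  | comp _ _ ih₁ ih₂ => exact fun h => h.elim ih₁ ih₂
  | star _ ih => exact ih

theorem varFree_embed (s : RegularExpression α) : VarFree (embed s : MixedExpr α V) :=
  fun R => not_occurs_embed R s

theorem VarFree.exists_embed {γ : MixedExpr α V} (h : VarFree γ) :
    ∃ t : RegularExpression α, γ = embed t := by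
  induction γ with
  | zero => exact ⟨0, rfl⟩
  | epsilon => exact ⟨1, rfl⟩
  | char x =>
    rcases x with x | R
    · exact ⟨.char x, rfl⟩
    · exact (h R rfl).elim
  | plus γ δ ihγ ihδ =>
    obtain ⟨h₁, h₂⟩ := (varFree_add _ _).1 h
    obtain ⟨t, rfl⟩ := ihγ h₁
    obtain ⟨u, rfl⟩ := ihδ h₂
    exact ⟨t + u, rfl⟩
  | comp γ δ ihγ ihδ =>
    obtain ⟨h₁, h₂⟩ := (varFree_mul _ _).1 h
    obtain ⟨t, rfl⟩ := ihγ h₁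
    obtain ⟨u, rfl⟩ := ihδ h₂
    exact ⟨t * u, rfl⟩
  | star γ ih =>
    obtain ⟨t, rfl⟩ := ih h
    exact ⟨t.star, rfl⟩

theorem substVar_add (R : V) (β γ δ : MixedExpr α V) :
    substVar R β (γ + δ) = substVar R β γ + substVar R β δ := rfl

theorem substVar_mul (R : V) (β γ δ : MixedExpr α V) :
    substVar R β (γ * δ) = substVar R β γ * substVar R β δ := rfl

theorem substVar_mvar (R S : V) (β : MixedExpr α V) :
    substVar R β (mvar S) = if S = R then β else mvar S := rfl

theorem substVar_of_not_occurs {R : V} {β γ : MixedExpr α V} (h : ¬ Occurs R γ) :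
    substVar R β γ = γ := by
  induction γ with
  | zero => rfl
  | epsilon => rfl
  | char x =>
    rcases x with x | S
    · rfl
    · exact if_neg h
  | plus γ δ ihγ ihδ =>
    exact congrArg₂ (· + ·) (ihγ fun h' => h (.inl h')) (ihδ fun h' => h (.inr h'))
  | comp γ δ ihγ ihδ =>
    exact congrArg₂ (· * ·) (ihγ fun h' => h (.inl h')) (ihδ fun h' => h (.inr h'))
  | star γ ih => exact congrArg RegularExpression.star (ih h)

theorem Occurs.of_substVar {R S : V} {β γ : MixedExpr α V} (h : Occurs S (substVar R β γ)) :
    Occurs S γ ∧ S ≠ R ∨ Occurs S β := by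
  induction γ with
  | zero => exact h.elim
  | epsilon => exact h.elim
  | char x =>
    rcases x with x | T
    · exact h.elim
    · change Occurs S (substVar R β (mvar T)) at h
      rw [substVar_mvar] at h
      split_ifs at h with hT
      · exact .inr h
      · obtain rfl : T = S := h
        exact .inl ⟨rfl, hT⟩
  | plus γ δ ihγ ihδ =>
    rcases h with h | h
    · exact (ihγ h).imp_left fun h => ⟨.inl h.1, h.2⟩
    · exact (ihδ h).imp_left fun h => ⟨.inr h.1, h.2⟩
  | comp γ δ ihγ ihδ =>
    rcases h with h | h
    · exact (ihγ h).imp_left fun h => ⟨.inl h.1, h.2⟩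
    · exact (ihδ h).imp_left fun h => ⟨.inr h.1, h.2⟩
  | star γ ih => exact ih h

theorem occurs_iff_of_exprEquiv {γ δ : MixedExpr α V} (h : ExprEquiv γ δ) (R : V) :
    Occurs R γ ↔ Occurs R δ := by
  induction h with
  | e7 _ _ ih₁ ih₂ => exact ih₁.trans ih₂
  | refl => rfl
  | symm _ ih => exact ih.symm
  | _ =>
    simp only [occurs_add, occurs_mul, *]
    try grind

theorem nil_mem_mul_iff {L M : Language α} : [] ∈ L * M ↔ [] ∈ L ∧ [] ∈ M := by
  simp [Language.mem_mul]

/-- A product contains the empty word iff both factors do, a sum iff one summand does; so the guard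
in front of a variable survives rebracketing and distribution. -/
theorem guarded_iff_of_exprEquiv {ρ : V → Language α} {γ δ : MixedExpr α V}
    (h : ExprEquiv γ δ) : Guarded ρ γ ↔ Guarded ρ δ := by
  induction h with
  | e7 _ _ ih₁ ih₂ => exact ih₁.trans ih₂
  | refl => rfl
  | symm _ ih => exact ih.symm
  | _ =>
    simp only [guarded_add, guarded_mul, varFree_add, varFree_mul, rightLinear_add,
      rightLinear_mul, mixedLang_add, mixedLang_mul, Language.mem_add, nil_mem_mul_iff, *]
    try grind

theorem RightLinear.substVar {R : V} {β γ : MixedExpr α V} (hβ : RightLinear β)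
    (hγ : RightLinear γ) : RightLinear (substVar R β γ) := by
  induction γ with
  | zero => trivial
  | epsilon => trivial
  | char x =>
    rcases x with x | S
    · trivial
    · change RightLinear (_root_.substVar R β (mvar S))
      rw [substVar_mvar]
      split_ifs
      · exact hβ
      · trivial
  | plus γ δ ihγ ihδ => exact ⟨ihγ hγ.1, ihδ hγ.2⟩
  | comp γ δ ihγ ihδ =>
    refine ⟨?_, ihδ hγ.2⟩
    rw [substVar_of_not_occurs (hγ.1 R)]
    exact hγ.1
  | star γ ih =>
    change VarFree (_root_.substVar R β γ)
    rw [substVar_of_not_occurs (hγ R)]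
    exact hγ

/-- Each replaced variable already stands behind a factor without the empty word, so only right
linearity of β matters. -/
theorem Guarded.substVar {ρ : V → Language α} {R : V} {β γ : MixedExpr α V}
    (hβ : Guarded ρ β) (hγ : Guarded ρ γ) : Guarded ρ (substVar R β γ) := by
  induction γ with
  | zero => trivial
  | epsilon => trivial
  | char x =>
    rcases x with x | S
    · trivial
    · exact hγ.elim
  | plus γ δ ihγ ihδ => exact ⟨ihγ hγ.1, ihδ hγ.2⟩
  | comp γ δ ihγ ihδ =>
    refine (guarded_mul ρ _ _).2 ?_
    rw [substVar_of_not_occurs (hγ.1 R)]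
    exact ⟨hγ.1, hβ.rightLinear.substVar hγ.2.1, hγ.2.2.imp_right ihδ⟩
  | star γ ih =>
    change VarFree (_root_.substVar R β γ)
    rw [substVar_of_not_occurs (hγ R)]
    exact hγ

/-- The interpretation `ρ` satisfies the equation `R ≈ β` unambiguously, and `β` contains only
variables of the equations `E`. -/
structure SatisfiesEq (ρ : V → Language α) (E : EqSystem α V) (R : V) (β : MixedExpr α V) :
    Prop where
  lang : mixedLang ρ β = ρ R
  unamb : Unamb ρ β
  isSome : ∀ S, Occurs S β → (E S).isSome

/-- All right-hand sides of `E` are satisfied by `ρ` and guarded. -/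
def GuardedSystem (ρ : V → Language α) (E : EqSystem α V) : Prop :=
  ∀ R β, E R = some β → SatisfiesEq ρ E R β ∧ Guarded ρ β

theorem SatisfiesEq.of_exprEquiv {ρ : V → Language α} {E : EqSystem α V} {R : V}
    {β γ : MixedExpr α V} (h : SatisfiesEq ρ E R β) (hβ : ExprEquiv β γ) :
    SatisfiesEq ρ E R γ where
  lang := (mixedLang_eq_of_exprEquiv ρ hβ).symm.trans h.lang
  unamb := (unamb_iff_of_exprEquiv ρ hβ).1 h.unamb
  isSome S hS := h.isSome S ((occurs_iff_of_exprEquiv hβ S).2 hS)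

theorem SatisfiesEq.mono {ρ : V → Language α} {E E₁ : EqSystem α V} {R : V}
    {β : MixedExpr α V} (h : SatisfiesEq ρ E R β)
    (hE : ∀ S, (E S).isSome → (E₁ S).isSome) : SatisfiesEq ρ E₁ R β :=
  ⟨h.lang, h.unamb, fun S hS => hE S (h.isSome S hS)⟩

theorem SatisfiesEq.substVar {ρ : V → Language α} {E E₁ : EqSystem α V} {R S : V}
    {β γ : MixedExpr α V} (hβ : SatisfiesEq ρ E R β) (hγ : SatisfiesEq ρ E S γ)
    (hR : ¬ Occurs R β) (hE : ∀ T, T ≠ R → (E T).isSome → (E₁ T).isSome) :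
    SatisfiesEq ρ E₁ S (substVar R β γ) where
  lang := (mixedLang_substVar ρ hβ.lang γ).trans hγ.lang
  unamb := unamb_substVar ρ hβ.lang hβ.unamb hγ.unamb
  isSome T hT := by
    rcases hT.of_substVar with ⟨h, hne⟩ | h
    · exact hE T hne (hγ.isSome T h)
    -- R itself drops out, because it does not occur in β.
    · exact hE T (fun e => hR (e ▸ h)) (hβ.isSome T h)

theorem isSome_iff_of_rel {A B : Type*} {r : A → B → Prop} {a : Option A} {b : Option B}
    (h : Option.Rel r a b) : a.isSome ↔ b.isSome := by
  cases h <;> simp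

theorem exists_of_rel_some {A B : Type*} {r : A → B → Prop} {a : Option A} {b : B}
    (h : Option.Rel r a (some b)) : ∃ c, a = some c ∧ r c b := by
  cases h with
  | some h => exact ⟨_, rfl, h⟩

theorem SolveStep.invariant {ρ : V → Language α} {c c' : EqSystem α V × EqSystem α V}
    (h : SolveStep c c') (hE : GuardedSystem ρ c.2)
    (hψ : ∀ R β, c.1 R = some β → SatisfiesEq ρ c.2 R β) :
    GuardedSystem ρ c'.2 ∧ ∀ R β, c'.1 R = some β → SatisfiesEq ρ c'.2 R β := by
  cases h with
  | arden ψ E R s β hR hβ =>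
    dsimp only at hE hψ ⊢
    have hsome : ∀ S, (E S).isSome →
        (Function.update E R (some (embed s.star * β)) S).isSome := by
      intro S hS
      by_cases h : S = R
      · simp [h]
      · simpa [h] using hS
    refine ⟨?_, fun S γ hS => (hψ S γ hS).mono hsome⟩
    intro S γ hS
    by_cases h : S = R
    · subst h
      rw [Function.update_self] at hS
      obtain rfl := Option.some.inj hS
      obtain ⟨hsat, ⟨-, -, hg⟩, hgβ⟩ := hE S _ hR
      -- A bare variable is never guarded, so the guard must be s.
      have hs : [] ∉ s.matches' := by
        rw [← mixedLang_embed ρ]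
        exact hg.resolve_right id
      -- The star contains the empty word and guards nothing; the guard is inherited from β.
      refine ⟨⟨mixedLang_arden ρ hs hsat.lang, unamb_arden ρ hsat.lang hsat.unamb, ?_⟩,
        varFree_embed _, hgβ.rightLinear, .inr hgβ⟩
      rintro T (hT | hT)
      · exact (not_occurs_embed _ _ hT).elim
      · exact hsome T (hsat.isSome T (.inr hT))
    · rw [Function.update_of_ne h] at hS
      exact ⟨(hE S γ hS).1.mono hsome, (hE S γ hS).2⟩
  | subst ψ E E₁ R β hR hβ hE₁ hrel =>
    dsimp only at hE hψ ⊢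
    obtain ⟨hsat, hg⟩ := hE R β hR
    have hsome : ∀ S, S ≠ R → (E S).isSome → (E₁ S).isSome := by
      intro S hS h
      have := hrel S hS
      exact (isSome_iff_of_rel this).1 h
    constructor
    · intro S δ hS
      have hne : S ≠ R := by
        rintro rfl
        simp [hE₁] at hS
      have h := hrel S hne
      rw [hS] at h
      obtain ⟨γ, hγ, he⟩ := exists_of_rel_some h
      obtain ⟨hγsat, hγg⟩ := hE S γ hγ
      exact ⟨(hsat.substVar hγsat hβ hsome).of_exprEquiv he,
        (guarded_iff_of_exprEquiv he).1 (hg.substVar hγg)⟩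
    · intro S δ hS
      by_cases h : S = R
      · subst h
        rw [Function.update_self] at hS
        obtain rfl := Option.some.inj hS
        refine ⟨hsat.lang, hsat.unamb, fun T hT => hsome T ?_ (hsat.isSome T hT)⟩
        rintro rfl
        exact hβ hT
      · rw [Function.update_of_ne h] at hS
        obtain ⟨γ, hγ, rfl⟩ := Option.map_eq_some_iff.1 hS
        exact hsat.substVar (hψ S γ hγ) hβ hsome

theorem Solves.satisfiesEq {ρ : V → Language α} {E ψ : EqSystem α V} (h : Solves E ψ)
    (hE : GuardedSystem ρ E) {R : V} {β : MixedExpr α V} (hR : ψ R = some β) :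
    SatisfiesEq ρ emptySystem R β := by
  obtain ⟨E₁, hrel, -, hsteps⟩ := h
  have h₁ : GuardedSystem ρ E₁ := by
    intro S γ hS
    have h := hrel S
    rw [hS] at h
    obtain ⟨δ, hδ, he⟩ := exists_of_rel_some h
    obtain ⟨hsat, hg⟩ := hE S δ hδ
    exact ⟨(hsat.of_exprEquiv he).mono fun T hT => (isSome_iff_of_rel (hrel T)).1 hT,
      (guarded_iff_of_exprEquiv he).1 hg⟩
  have key : ∀ c : EqSystem α V × EqSystem α V,
      Relation.ReflTransGen SolveStep (emptySystem, E₁) c →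
      GuardedSystem ρ c.2 ∧ ∀ R β, c.1 R = some β → SatisfiesEq ρ c.2 R β := by
    intro c hc
    induction hc with
    | refl => exact ⟨h₁, fun R β h => by simp [emptySystem] at h⟩
    | tail _ h ih => exact h.invariant ih.1 ih.2
  exact (key _ hsteps).2 R β hR

end Invariants

/-! ### The subtraction equations -/

section SubtractionEquations

open scoped Classical

variable {α : Type*}

/-- The intended solution of the subtraction equations. -/
def differenceLang (p : RegularExpression α × RegularExpression α) : Language α :=
  p.1.matches' - p.2.matches'

variable [DecidableEq α] {cnf : RegularExpression α → RegularExpression α}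

theorem mem_differenceLang_cnf_deriv (hcnf : IsCanonicalForm cnf) (r s : RegularExpression α)
    (x : α) (w : List α) :
    w ∈ differenceLang (cnf (r.deriv x), cnf (s.deriv x)) ↔ x :: w ∈ differenceLang (r, s) := by
  simp only [differenceLang, (hcnf.similar _).matches'_eq, Language.mem_sub,
    cons_mem_matches'_iff]

/-- The right-hand side built from the letters of a list denotes the words of the difference that
are empty or start with one of these letters; it is unambiguous and guarded. -/
theorem foldr_deriv_properties (hcnf : IsCanonicalForm cnf) (r s : RegularExpression α)
    (t : MixedExpr α (RegularExpression α × RegularExpression α))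
    (ht : [] ∈ differenceLang (r, s) ∧ t = 1 ∨ [] ∉ differenceLang (r, s) ∧ t = 0) (l : List α) (hl : l.Nodup) :
    let γ := l.foldr
      (fun x γ => .char (.inl x) * mvar (cnf (r.deriv x), cnf (s.deriv x)) + γ) t
    (∀ w, w ∈ mixedLang differenceLang γ ↔
      w ∈ differenceLang (r, s) ∧ ∀ x ∈ w.head?, x ∈ l) ∧
    Unamb differenceLang γ ∧ Guarded differenceLang γ ∧
    ∀ S, Occurs S γ → ∃ x, S = (cnf (r.deriv x), cnf (s.deriv x)) := by
  induction l with
  | nil =>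
    rcases ht with ⟨h, rfl⟩ | ⟨h, rfl⟩
    · refine ⟨fun w => ?_, trivial, trivial, fun S hS => hS.elim⟩
      change w ∈ (1 : Language α) ↔ _
      rw [Language.mem_one]
      cases w <;> simp [h]
    · refine ⟨fun w => ?_, trivial, trivial, fun S hS => hS.elim⟩
      change w ∈ (0 : Language α) ↔ _
      cases w <;> simp [h, Language.notMem_zero]
  | cons x l ih =>
    obtain ⟨hx, hl⟩ := List.nodup_cons.1 hl
    obtain ⟨ih₁, ih₂, ih₃, ih₄⟩ := ih hl
    dsimp only [List.foldr_cons]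
    generalize l.foldr (fun x γ => .char (.inl x) *
      mvar (cnf (r.deriv x), cnf (s.deriv x)) + γ) t = γ at *
    have hmem : ∀ w, w ∈ mixedLang differenceLang
        (.char (.inl x) * mvar (cnf (r.deriv x), cnf (s.deriv x))) ↔
        ∃ v, w = x :: v ∧ x :: v ∈ differenceLang (r, s) := by
      intro w
      rw [mixedLang_mul]
      change w ∈ ({[x]} : Language α) * differenceLang _ ↔ _
      constructor
      · rintro ⟨_, rfl, v, hv, rfl⟩
        exact ⟨v, rfl, (mem_differenceLang_cnf_deriv hcnf r s x v).1 hv⟩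
      · rintro ⟨v, rfl, hv⟩
        exact ⟨[x], rfl, v, (mem_differenceLang_cnf_deriv hcnf r s x v).2 hv, rfl⟩
    refine ⟨fun w => ?_, ⟨⟨fun _ => trivial, fun _ => trivial, ?_⟩, ih₂, ?_⟩,
      ⟨⟨fun _ => id, trivial, .inl ?_⟩, ih₃⟩, ?_⟩
    · rw [mixedLang_add, Language.mem_add, hmem, ih₁]
      cases w with
      | nil => simp
      | cons y w =>
        simp only [List.cons.injEq, List.head?_cons, Option.mem_some_iff, forall_eq',
          List.mem_cons]
        constructor
        · rintro (⟨v, ⟨rfl, rfl⟩, h⟩ | ⟨h, h'⟩)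
          · exact ⟨h, .inl rfl⟩
          · exact ⟨h, .inr h'⟩
        · rintro ⟨h, rfl | h'⟩
          · exact .inl ⟨w, ⟨rfl, rfl⟩, h⟩
          · exact .inr ⟨h, h'⟩
    · rintro _ rfl _ rfl b _ b' _ e
      exact ⟨rfl, List.append_cancel_left e⟩
    -- A common word would begin with x, but nonempty words of the tail begin with letters of l,
    -- which omits x.
    · intro w hw hw'
      obtain ⟨v, rfl, -⟩ := (hmem w).1 hw
      exact hx (((ih₁ _).1 hw').2 x rfl)
    · intro h
      exact List.cons_ne_nil x [] (id h : [] = [x]).symm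
    · rintro S ((hS | hS) | hS)
      · exact hS.elim
      · exact ⟨x, ((occurs_mvar _ _).1 hS).symm⟩
      · exact ih₄ S hS

theorem guardedSystem_subtractionEquations [Fintype α] (hcnf : IsCanonicalForm cnf)
    (r s : RegularExpression α) :
    GuardedSystem differenceLang (subtractionEquations cnf r s) := by
  intro p β hp
  unfold subtractionEquations at hp
  split_ifs at hp with hmem
  obtain rfl := Option.some.inj hp
  by_cases h0 : p.1.matches' = 0
  · rw [subtractionRhs, if_pos h0]
    refine ⟨⟨?_, trivial, fun S hS => hS.elim⟩, trivial⟩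
    change 0 = p.1.matches' - p.2.matches'
    rw [h0, Language.sub_def]
    exact (Set.empty_sdiff _).symm
  · rw [subtractionRhs, if_neg h0]
    obtain ⟨h₁, h₂, h₃, h₄⟩ := foldr_deriv_properties hcnf p.1 p.2
      (if [] ∈ p.1.matches' ∧ [] ∉ p.2.matches' then 1 else 0)
      (by
        split_ifs with h
        · exact .inl ⟨h, rfl⟩
        · exact .inr ⟨h, rfl⟩)
      (Finset.univ : Finset α).toList (Finset.nodup_toList _)
    refine ⟨⟨?_, h₂, ?_⟩, h₃⟩
    · ext w
      rw [h₁]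
      simp
    · intro S hS
      obtain ⟨x, rfl⟩ := h₄ S hS
      unfold subtractionEquations
      rw [if_pos ⟨cnf_deriv_mem_canonicalDescendants hcnf hmem.1 x,
        cnf_deriv_mem_canonicalDescendants hcnf hmem.2 x⟩]
      rfl

end SubtractionEquations

/-! ### Existence of a run of the solving process -/

section Existence

open scoped Classical

variable {α V : Type*}

theorem linearSum_cons (s : RegularExpression α) (R : V) (l : List (RegularExpression α × V))
    (t : RegularExpression α) :
    linearSum ((s, R) :: l) t = embed s * mvar R + linearSum l t := rfl

theorem exprEquiv_add_left_comm (γ₁ γ₂ γ₃ : MixedExpr α V) :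
    ExprEquiv (γ₁ + (γ₂ + γ₃)) (γ₂ + (γ₁ + γ₃)) :=
  (ExprEquiv.e3 _ _ _).e7 (((ExprEquiv.e5 _ _).e6_left _).e7 (ExprEquiv.e3 _ _ _).symm)

theorem ExprEquiv.add {γ γ' δ δ' : MixedExpr α V} (h : ExprEquiv γ γ') (h' : ExprEquiv δ δ') :
    ExprEquiv (γ + δ) (γ' + δ') :=
  (h.e6_left _).e7 (h'.e6_right _)

/-! ### Linear sums and normal forms -/

theorem exprEquiv_linearSum_of_perm {l l' : List (RegularExpression α × V)} (h : l.Perm l')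
    (t : RegularExpression α) : ExprEquiv (linearSum l t) (linearSum l' t) := by
  induction h with
  | nil => exact .refl _
  | cons p _ ih => exact ih.e6_right _
  | swap p q l => exact exprEquiv_add_left_comm _ _ _
  | trans _ _ ih₁ ih₂ => exact ih₁.e7 ih₂

theorem exists_perm_cons_of_mem_snd {l : List (RegularExpression α × V)} {R : V}
    (h : R ∈ l.map Prod.snd) : ∃ s l', l.Perm ((s, R) :: l') := by
  obtain ⟨⟨s, S⟩, hm, rfl⟩ := List.mem_map.1 h
  exact ⟨s, l.erase (s, S), List.perm_cons_erase hm⟩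

theorem exists_nodup_linearSum (l : List (RegularExpression α × V)) (t : RegularExpression α) :
    ∃ l' : List (RegularExpression α × V), ExprEquiv (linearSum l t) (linearSum l' t) ∧
      (l'.map Prod.snd).Nodup := by
  induction l with
  | nil => exact ⟨[], .refl _, List.nodup_nil⟩
  | cons p l ih =>
    obtain ⟨s, R⟩ := p
    obtain ⟨l', he, hn⟩ := ih
    by_cases hR : R ∈ l'.map Prod.snd
    · obtain ⟨u, m, hm⟩ := exists_perm_cons_of_mem_snd hR
      -- A repeated variable has its two coefficients merged by right distributivity.
      refine ⟨(s + u, R) :: m, ?_, ?_⟩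
      · refine ((he.e7 (exprEquiv_linearSum_of_perm hm t)).e6_right _).e7 ?_
        exact (ExprEquiv.e3 _ _ _).e7 ((ExprEquiv.e4 _ _ _).e6_left _)
      · exact ((hm.map Prod.snd).nodup_iff.1 hn)
    · exact ⟨(s, R) :: l', he.e6_right _, List.nodup_cons.2 ⟨hR, hn⟩⟩

theorem occurs_linearSum (R : V) (l : List (RegularExpression α × V))
    (t : RegularExpression α) : Occurs R (linearSum l t) ↔ R ∈ l.map Prod.snd := by
  induction l with
  | nil =>
    change Occurs R (embed t) ↔ _
    simp [not_occurs_embed]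
  | cons p l ih =>
    obtain ⟨s, S⟩ := p
    rw [linearSum_cons, occurs_add, occurs_mul, occurs_mvar, ih, List.map_cons, List.mem_cons,
      eq_comm (a := R)]
    simp [not_occurs_embed]

/-- The expression is equivalent to a linear sum. -/
def IsLinear (γ : MixedExpr α V) : Prop := ∃ l t, ExprEquiv γ (linearSum l t)

theorem IsLinear.exists_normalForm {γ : MixedExpr α V} (h : IsLinear γ) (R : V) :
    ∃ l t, ExprEquiv γ (linearSum l t) ∧ IsNormalForm R (linearSum l t) := by
  obtain ⟨l, t, h⟩ := h
  obtain ⟨l', he, hn⟩ := exists_nodup_linearSum l t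
  by_cases hR : R ∈ l'.map Prod.snd
  · obtain ⟨u, m, hm⟩ := exists_perm_cons_of_mem_snd hR
    exact ⟨_, t, h.e7 (he.e7 (exprEquiv_linearSum_of_perm hm t)),
      .inr ⟨u, m, t, rfl, (hm.map Prod.snd).nodup_iff.1 hn⟩⟩
  · exact ⟨l', t, h.e7 he, .inl fun h => hR ((occurs_linearSum _ _ _).1 h)⟩

theorem IsLinear.of_exprEquiv {γ δ : MixedExpr α V} (h : IsLinear δ) (he : ExprEquiv γ δ) :
    IsLinear γ := by
  obtain ⟨l, t, h⟩ := h
  exact ⟨l, t, he.e7 h⟩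

theorem isLinear_linearSum (l : List (RegularExpression α × V)) (t : RegularExpression α) :
    IsLinear (linearSum l t) := ⟨l, t, .refl _⟩

theorem exprEquiv_linearSum_add (l l' : List (RegularExpression α × V))
    (t t' : RegularExpression α) :
    ExprEquiv (linearSum l t + linearSum l' t') (linearSum (l ++ l') (t + t')) := by
  induction l with
  | nil =>
    induction l' with
    | nil => exact .refl _
    | cons p l' ih => exact (exprEquiv_add_left_comm _ _ _).e7 (ih.e6_right _)
  | cons p l ih => exact (ExprEquiv.e3 _ _ _).symm.e7 (ih.e6_right _)

theorem IsLinear.add {γ δ : MixedExpr α V} (hγ : IsLinear γ) (hδ : IsLinear δ) :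
    IsLinear (γ + δ) := by
  obtain ⟨l, t, h⟩ := hγ
  obtain ⟨l', t', h'⟩ := hδ
  exact ⟨_, _, (h.add h').e7 (exprEquiv_linearSum_add l l' t t')⟩

theorem isLinear_embed_mul_linearSum (u : RegularExpression α)
    (l : List (RegularExpression α × V)) (t : RegularExpression α) :
    IsLinear (embed u * linearSum l t) := by
  induction l with
  | nil => exact isLinear_linearSum [] (u * t)
  | cons p l ih =>
    obtain ⟨l', t', h⟩ := ih
    exact ⟨(u * p.1, p.2) :: l', t', (ExprEquiv.e1 _ _ _).e7 ((ExprEquiv.e2 _ _ _).add h)⟩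

/-- `ExprEquiv` may not rewrite inside a factor of a product, so linearity of β alone would not
help; it is required after multiplication by a coefficient. -/
theorem isLinear_substVar_linearSum {R : V} {β : MixedExpr α V}
    (hβ : ∀ u, IsLinear (embed u * β)) (l : List (RegularExpression α × V))
    (t : RegularExpression α) : IsLinear (substVar R β (linearSum l t)) := by
  induction l with
  | nil =>
    change IsLinear (substVar R β (embed t))
    rw [substVar_of_not_occurs (not_occurs_embed R t)]
    exact isLinear_linearSum [] t
  | cons p l ih =>
    obtain ⟨s, S⟩ := p
    rw [linearSum_cons, substVar_add, substVar_mul,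
      substVar_of_not_occurs (not_occurs_embed R s), substVar_mvar]
    split_ifs
    · exact (hβ s).add ih
    · obtain ⟨l', t', h⟩ := ih
      exact ⟨(s, S) :: l', t', h.e6_right _⟩

/-- All right-hand sides are linear sums in normal form. -/
def NormalSystem (E : EqSystem α V) : Prop :=
  ∀ R β, E R = some β → (∃ l t, β = linearSum l t) ∧ IsNormalForm R β

/-! ### Eliminating the variables -/

theorem exists_subst_step {ψ E : EqSystem α V} {R : V} {β : MixedExpr α V} (hR : E R = some β)
    (hβ : ¬ Occurs R β) (hlin : ∀ u, IsLinear (embed u * β))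
    (hE : ∀ S, S ≠ R → ∀ γ, E S = some γ → ∃ l t, γ = linearSum l t) :
    ∃ ψ₁ E₁ : EqSystem α V, SolveStep (ψ, E) (ψ₁, E₁) ∧ NormalSystem E₁ ∧
      (∀ S, (E₁ S).isSome ↔ S ≠ R ∧ (E S).isSome) ∧
      ∀ S, (ψ₁ S).isSome ↔ S = R ∨ (ψ S).isSome := by
  -- The new right-hand sides are chosen equation by equation, already in normal form.
  have hex : ∀ S, ∃ δ : Option (MixedExpr α V), (S = R → δ = none) ∧
      (S ≠ R → Option.Rel (fun γ δ => ExprEquiv (substVar R β γ) δ) (E S) δ) ∧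
      ∀ γ, δ = some γ → (∃ l t, γ = linearSum l t) ∧ IsNormalForm S γ := by
    intro S
    by_cases hS : S = R
    · exact ⟨none, fun _ => rfl, fun h => (h hS).elim, by simp⟩
    · rcases hES : E S with - | γ
      · exact ⟨none, fun _ => rfl, fun _ => .none, by simp⟩
      · obtain ⟨l, t, rfl⟩ := hE S hS γ hES
        obtain ⟨l', t', he, hn⟩ := (isLinear_substVar_linearSum hlin l t).exists_normalForm S
        refine ⟨some (linearSum l' t'), fun h => (hS h).elim, fun _ => .some he, ?_⟩
        rintro _ ⟨⟩
        exact ⟨⟨l', t', rfl⟩, hn⟩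
  choose E₁ h₁ h₂ h₃ using hex
  refine ⟨_, E₁, SolveStep.subst ψ E E₁ R β hR hβ (h₁ R rfl) h₂, h₃, fun S => ?_, fun S => ?_⟩
  · by_cases hS : S = R
    · simp [hS, h₁ R rfl]
    · simp [hS, isSome_iff_of_rel (h₂ S hS)]
  · by_cases hS : S = R
    · simp [hS]
    · simp [hS]

theorem exists_eliminate {ψ E : EqSystem α V} (hE : NormalSystem E) {R : V}
    (hR : (E R).isSome) :
    ∃ ψ₁ E₁ : EqSystem α V, Relation.ReflTransGen SolveStep (ψ, E) (ψ₁, E₁) ∧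
      NormalSystem E₁ ∧ (∀ S, (E₁ S).isSome ↔ S ≠ R ∧ (E S).isSome) ∧
      ∀ S, (ψ₁ S).isSome ↔ S = R ∨ (ψ S).isSome := by
  obtain ⟨β, hβ⟩ := Option.isSome_iff_exists.1 hR
  obtain ⟨⟨l, t, hl⟩, hocc | ⟨s, m, u, rfl, hn⟩⟩ := hE R β hβ
  · obtain ⟨ψ₁, E₁, hs, h⟩ := exists_subst_step (ψ := ψ) hβ hocc
      (fun v => hl ▸ isLinear_embed_mul_linearSum v l t) fun S _ γ hγ => (hE S γ hγ).1
    exact ⟨ψ₁, E₁, .single hs, h⟩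
  · have hocc : ¬ Occurs R (linearSum m u) := fun h =>
      (List.nodup_cons.1 hn).1 ((occurs_linearSum _ _ _).1 h)
    have hstep := SolveStep.arden ψ E R s (linearSum m u) hβ hocc
    obtain ⟨ψ₁, E₁, hs, hnorm, hsome, hψ⟩ := exists_subst_step (ψ := ψ)
      (E := Function.update E R (some (embed s.star * linearSum m u))) (R := R)
      (Function.update_self _ _ _)
      (fun h => ((occurs_mul _ _ _).1 h).elim (not_occurs_embed R _) hocc)
      -- After Arden the right-hand side is a product, not a linear sum; an outer coefficient is
      -- absorbed by associativity and then distributed.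
      (fun v => (isLinear_embed_mul_linearSum (v * s.star) m u).of_exprEquiv (.e2 _ _ _))
      (fun S hS γ hγ => (hE S γ (by rwa [Function.update_of_ne hS] at hγ)).1)
    refine ⟨ψ₁, E₁, (Relation.ReflTransGen.single hstep).tail hs, hnorm, fun S => ?_, hψ⟩
    rw [hsome]
    refine and_congr_right fun hS => ?_
    rw [Function.update_of_ne hS]

/-- Induction on the set of unsolved variables; the domain of ψ only grows, so every eliminated
variable keeps a value. -/
theorem exists_solving_run (D : Finset V) {ψ E : EqSystem α V} (hE : NormalSystem E)
    (hD : ∀ R, (E R).isSome ↔ R ∈ D) :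
    ∃ ψ' : EqSystem α V, Relation.ReflTransGen SolveStep (ψ, E) (ψ', emptySystem) ∧
      ∀ R, (R ∈ D ∨ (ψ R).isSome) → (ψ' R).isSome := by
  induction D using Finset.induction_on generalizing ψ E with
  | empty =>
    obtain rfl : E = emptySystem := by
      funext R
      simpa [emptySystem] using hD R
    exact ⟨ψ, .refl, by simp⟩
  | insert R D hR ih =>
    obtain ⟨ψ₁, E₁, hs, hn, hE₁, hψ₁⟩ := exists_eliminate (ψ := ψ) hE ((hD R).2 (by simp))
    obtain ⟨ψ', hs', hψ'⟩ := ih (ψ := ψ₁) hn (fun S => by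
      rw [hE₁, hD, Finset.mem_insert]
      constructor
      · rintro ⟨h, h'⟩
        exact h'.resolve_left h
      · intro h
        exact ⟨by rintro rfl; exact hR h, .inr h⟩)
    refine ⟨ψ', hs.trans hs', fun S hS => hψ' S ?_⟩
    rw [hψ₁]
    rw [Finset.mem_insert] at hS
    tauto

theorem exists_solves {E : EqSystem α V} (hfin : {R | (E R).isSome}.Finite)
    (hE : ∀ R β, E R = some β → IsLinear β) :
    ∃ ψ, Solves E ψ ∧ ∀ R, (E R).isSome → (ψ R).isSome := by
  have hex : ∀ R, ∃ δ : Option (MixedExpr α V), Option.Rel ExprEquiv (E R) δ ∧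
      ∀ γ, δ = some γ → (∃ l t, γ = linearSum l t) ∧ IsNormalForm R γ := by
    intro R
    rcases hR : E R with - | γ
    · exact ⟨none, .none, by simp⟩
    · obtain ⟨l, t, he, hn⟩ := (hE R γ hR).exists_normalForm R
      refine ⟨some (linearSum l t), .some he, ?_⟩
      rintro _ ⟨⟩
      exact ⟨⟨l, t, rfl⟩, hn⟩
  choose E₁ hrel hnorm using hex
  obtain ⟨ψ, hrun, hψ⟩ := exists_solving_run hfin.toFinset (ψ := emptySystem) (E := E₁) hnorm
    (fun R => by simp [isSome_iff_of_rel (hrel R)])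
  exact ⟨ψ, ⟨E₁, hrel, fun R β h => (hnorm R β h).2, hrun⟩,
    fun R hR => hψ R (.inl (by simpa using hR))⟩

end Existence

theorem isLinear_subtractionRhs {α : Type*} [Fintype α] [DecidableEq α]
    (cnf : RegularExpression α → RegularExpression α) (r s : RegularExpression α) :
    IsLinear (subtractionRhs cnf r s) := by
  unfold subtractionRhs
  split_ifs
  · exact isLinear_linearSum [] 0
  all_goals
    generalize (Finset.univ : Finset α).toList = l
    induction l with
    | nil => first | exact isLinear_linearSum [] 1 | exact isLinear_linearSum [] 0
    | cons x l ih =>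
      obtain ⟨l', t, h⟩ := ih
      exact ⟨(.char x, _) :: l', t, h.e6_right _⟩

theorem exists_isSubtraction {α : Type*} [Fintype α] [DecidableEq α]
    {cnf : RegularExpression α → RegularExpression α} (hcnf : IsCanonicalForm cnf)
    (r s : RegularExpression α) : ∃ γ, IsSubtraction cnf r s γ := by
  have hsome : ∀ p, (subtractionEquations cnf r s p).isSome ↔
      p.1 ∈ canonicalDescendants cnf r ∧ p.2 ∈ canonicalDescendants cnf s := by
    intro p
    unfold subtractionEquations
    split_ifs with h <;> simp [h]
  obtain ⟨ψ, hψ, hdom⟩ := exists_solves (E := subtractionEquations cnf r s)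
    (((finite_canonicalDescendants hcnf r).prod (finite_canonicalDescendants hcnf s)).subset
      fun p hp => (hsome p).1 hp)
    (by
      intro p β hp
      unfold subtractionEquations at hp
      split_ifs at hp
      obtain rfl := Option.some.inj hp
      exact isLinear_subtractionRhs cnf p.1 p.2)
  obtain ⟨γ, hγ⟩ := Option.isSome_iff_exists.1 (hdom (cnf r, cnf s)
    ((hsome _).2 ⟨cnf_mem_canonicalDescendants r, cnf_mem_canonicalDescendants s⟩))
  exact ⟨γ, ψ, hψ, hγ⟩

theorem mainTheorem3 {α : Type*} [Fintype α] [DecidableEq α]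
    (cnf : RegularExpression α → RegularExpression α) (hcnf : IsCanonicalForm cnf)
    (r s : RegularExpression α) :
    (∃ γ, IsSubtraction cnf r s γ) ∧
    ∀ γ, IsSubtraction cnf r s γ →
      ∃ t : RegularExpression α, γ = embed t ∧
        ¬ IsAmbiguous emptySystem γ ∧
        t.matches' = r.matches' - s.matches' := by
  refine ⟨exists_isSubtraction hcnf r s, ?_⟩
  rintro γ ⟨ψ, hψ, hγ⟩
  have h := hψ.satisfiesEq (guardedSystem_subtractionEquations hcnf r s) hγ
  obtain ⟨t, rfl⟩ := VarFree.exists_embed (γ := γ) fun R hR => by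
    simpa [emptySystem] using h.isSome R hR
  refine ⟨t, rfl, ?_, ?_⟩
  · rintro ⟨v₁, v₂, hne, h₁, h₂, e⟩
    exact hne (h.unamb.parse_unique _ h₁ h₂ e)
  · rw [← mixedLang_embed differenceLang, h.lang, differenceLang,
      (hcnf.similar r).matches'_eq, (hcnf.similar s).matches'_eq]
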